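/- Let $c\ge 0$ and let $\mathbb H_c=L^2(\mathbb R,e^{-2ct}\,dt)$ be the Hilbert space of complex-valued functions that are square-integrable for the measure $e^{-2ct}\,dt$. Let $\partial_c$ be the unbounded operator $f\mapsto f'$ on $\mathbb H_c$ whose domain consists of the $f\in\mathbb H_c$ that are (represented by) locally absolutely continuous functions on $\mathbb R$ with $f'\in\mathbb H_c$. Then the spectral operator $\mathfrak a_c=\zeta(\partial_c)$ is well defined by the measurable functional calculus for unbounded normal operators: there is a resolution of the identity $E$ on the Borel sets of $\mathbb C$ with $\partial_c=\int\lambda\,dE(\lambda)$, and $\mathfrak a_c=\int\zeta(\lambda)\,dE(\lambda)$, with domain $\{f\in\mathbb H_c:\int|\zeta(\lambda)|^2\,d\langle E(\lambda)f,f\rangle<\infty\}$, where $\zeta$ is the Riemann zeta function (its value at the pole $1$ is immaterial). Call an operator $A:D(A)\subset\mathbb H_c\to\mathbb H_c$ invertible if there is a bounded linear operator $B$ defined on all of $\mathbb H_c$, with range $D(A)$, such that $ABu=u$ for all $u\in\mathbb H_c$ and $BAv=v$ for all $v\in D(A)$. Put $L_c=\{s\in\mathbb C:\operatorname{Re}s=c,\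 s\ne 1\}$. Then $$\mathfrak a_c\text{ is invertible}\iff 0\notin\overline{\{\zeta(s):s\in L_c\}}.$$ Moreover, $0\notin\overline{\{\zeta(s):s\in L_c\}}$ if and only if $\zeta$ has no zeros on $L_c$ and there is no infinite sequence $(s_n)_{n\ge1}$ of distinct points of $L_c$ such that $\zeta(s_n)\to0$ as $n\to\infty$. -/

import Mathlib

open MeasureTheory

noncomputable section

namespace SpectralOp

section Abstract

variable {H : Type*} [NormedAddCommGroup H] [InnerProductSpace ℂ H] [CompleteSpace H]

/-- A resolution of the identity (projection-valued measure) on the Borel sets of `ℂ`, acting on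
the Hilbert space `H`. The value on non-measurable sets is fixed to be `0`. -/
structure ResolutionOfIdentity (H : Type*) [NormedAddCommGroup H] [InnerProductSpace ℂ H]
    [CompleteSpace H] where
  proj : Set ℂ → H →L[ℂ] H
  isStarProjection : ∀ s, MeasurableSet s → IsStarProjection (proj s)
  proj_of_not_measurable : ∀ s, ¬ MeasurableSet s → proj s = 0
  proj_univ : proj Set.univ = 1
  proj_inter : ∀ s t, MeasurableSet s → MeasurableSet t → proj (s ∩ t) = proj s * proj t
  hasSum_iUnion : ∀ s : ℕ → Set ℂ, (∀ n, MeasurableSet (s n)) →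
    Pairwise (Function.onFun Disjoint s) →
    ∀ x : H, HasSum (fun n => proj (s n) x) (proj (⋃ n, s n) x)

namespace ResolutionOfIdentity

theorem proj_empty (E : ResolutionOfIdentity H) (x : H) : E.proj ∅ x = 0 := by
  have h := E.hasSum_iUnion (fun _ => ∅) (fun _ => MeasurableSet.empty)
    (fun _ _ _ => disjoint_bot_left) x
  exact tendsto_nhds_unique tendsto_const_nhds h.summable.tendsto_atTop_zero

theorem re_inner_nonneg (E : ResolutionOfIdentity H) (x : H) {s : Set ℂ} (hs : MeasurableSet s) :
    0 ≤ (inner ℂ x (E.proj s x)).re := by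
  have hp := E.isStarProjection s hs
  have h1 : E.proj s x = E.proj s (E.proj s x) := by
    conv_lhs => rw [← hp.isIdempotentElem.eq]
    rfl
  have h2 : inner ℂ x (E.proj s x) = inner ℂ (E.proj s x) (E.proj s x) := by
    conv_lhs => rw [h1, ← ContinuousLinearMap.adjoint_inner_left,
      ← ContinuousLinearMap.star_eq_adjoint, hp.isSelfAdjoint.star_eq]
  rw [h2]
  exact inner_self_nonneg (𝕜 := ℂ)

/-- The scalar spectral measure `s ↦ ⟨E(s) x, x⟩`. -/
def scalarMeasure (E : ResolutionOfIdentity H) (x : H) : Measure ℂ :=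
  Measure.ofMeasurable (fun s _ => ENNReal.ofReal (inner ℂ x (E.proj s x)).re)
    (by simp [E.proj_empty])
    (by
      intro s hs hd
      have h := E.hasSum_iUnion s hs hd x
      have h2 : HasSum (fun n => (inner ℂ x (E.proj (s n) x)).re)
          (inner ℂ x (E.proj (⋃ n, s n) x)).re :=
        (h.mapL (innerSL ℂ x)).mapL Complex.reCLM
      rw [← h2.tsum_eq, ENNReal.ofReal_tsum_of_nonneg (fun n => E.re_inner_nonneg x (hs n))
        h2.summable])

/-- `E.IsIntegral φ A` says that `A` is the (possibly unbounded) operator `∫ φ dE`: its domain is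
`{x | ∫ |φ|² d⟨E x, x⟩ < ∞}`, and `⟨A x, x⟩ = ∫ φ d⟨E x, x⟩` there. By polarization, and since this
domain is dense, these conditions determine `A`. The Mathlib inner product is linear in its second
argument. -/
def IsIntegral (E : ResolutionOfIdentity H) (φ : ℂ → ℂ) (A : H →ₗ.[ℂ] H) : Prop :=
  (∀ x : H, x ∈ A.domain ↔ MemLp φ 2 (E.scalarMeasure x)) ∧
  ∀ x : A.domain, inner ℂ (x : H) (A x) = ∫ z, φ z ∂(E.scalarMeasure (x : H))

end ResolutionOfIdentity

/-- `A = φ(N)` in the sense of the measurable functional calculus for unbounded normal operators: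
`N = ∫ λ dE` and `A = ∫ φ dE` for a resolution of the identity `E` (the one of `N`; the spectral
theorem provides it for every normal `N`, and it is unique). -/
def IsFunctionOf (N : H →ₗ.[ℂ] H) (φ : ℂ → ℂ) (A : H →ₗ.[ℂ] H) : Prop :=
  ∃ E : ResolutionOfIdentity H, E.IsIntegral (fun z => z) N ∧ E.IsIntegral φ A

open Classical in
/-- The operator `φ(N)`. If there is no such operator (`N` is not normal or `φ` is not
measurable), the value is the zero operator with domain `{0}`. -/
def functionalCalculus (N : H →ₗ.[ℂ] H) (φ : ℂ → ℂ) : H →ₗ.[ℂ] H :=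
  if h : ∃ A, IsFunctionOf N φ A then h.choose else ⊥

/-- A possibly unbounded operator `A` is invertible if there is a bounded operator `B`, defined on
the whole space and with range the domain of `A`, such that `A B u = u` for all `u` and
`B A v = v` for all `v` in the domain of `A`. -/
def IsInvertible (A : H →ₗ.[ℂ] H) : Prop :=
  ∃ B : H →L[ℂ] H, Set.range B = A.domain ∧
    (∀ (u : H) (hu : B u ∈ A.domain), A ⟨B u, hu⟩ = u) ∧
    ∀ v : A.domain, B (A v) = v

end Abstract

/-- The measure `e^{-2ct} dt` on the real line. -/
def weight (c : ℝ) : Measure ℝ :=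
  (volume : Measure ℝ).withDensity fun t => ENNReal.ofReal (Real.exp (-2 * c * t))

/-- The weighted Hilbert space `L²(ℝ, e^{-2ct} dt)` of complex-valued functions. -/
abbrev Hc (c : ℝ) : Type := Lp ℂ 2 (weight c)

theorem volume_ac_weight (c : ℝ) : (volume : Measure ℝ) ≪ weight c := by
  refine withDensity_absolutelyContinuous' (by fun_prop) ?_
  filter_upwards with t
  simpa using Real.exp_pos _

theorem weight_ac_volume (c : ℝ) : weight c ≪ (volume : Measure ℝ) :=
  withDensity_absolutelyContinuous _ _

/-- Local absolute continuity on the real line. -/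
def IsAC (g : ℝ → ℂ) : Prop := ∀ a b : ℝ, AbsolutelyContinuousOnInterval g a b

theorem IsAC.continuous {g : ℝ → ℂ} (hg : IsAC g) : Continuous g := by
  rw [continuous_iff_continuousAt]
  intro x
  refine (hg (x - 1) (x + 1)).continuousOn.continuousAt ?_
  rw [Set.uIcc_of_le (by linarith)]
  exact Icc_mem_nhds (by linarith) (by linarith)

theorem IsAC.ae_differentiableAt {g : ℝ → ℂ} (hg : IsAC g) :
    ∀ᵐ t : ℝ, DifferentiableAt ℝ g t := by
  have h : LocallyBoundedVariationOn g Set.univ := by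
    intro a b _ _
    rcases le_total a b with hab | hab
    · have := (hg a b).boundedVariationOn
      rw [Set.uIcc_of_le hab] at this
      simpa [BoundedVariationOn] using this
    · have hsub : (Set.univ ∩ Set.Icc a b).Subsingleton := by
        rw [Set.univ_inter]
        exact Set.subsingleton_Icc_of_ge hab
      rw [BoundedVariationOn, eVariationOn.subsingleton _ hsub]
      simp
  exact h.ae_differentiableAt

/-- The graph of the infinitesimal shift: pairs `(f, h)` such that `f` has a locally absolutely
continuous representative `g` whose derivative represents `h`. -/
def shiftGraph (c : ℝ) : Submodule ℂ (Hc c × Hc c) where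
  carrier := {p | ∃ g : ℝ → ℂ, IsAC g ∧ p.1 =ᵐ[weight c] g ∧ p.2 =ᵐ[weight c] deriv g}
  zero_mem' := by
    refine ⟨fun _ => 0, fun a b => ?_, Lp.coeFn_zero _ _ _, ?_⟩
    · exact (LipschitzWith.const (0 : ℂ)).lipschitzOnWith.absolutelyContinuousOnInterval
    · filter_upwards [Lp.coeFn_zero ℂ 2 (weight c)] with t ht
      simpa using ht
  add_mem' := by
    rintro ⟨f₁, h₁⟩ ⟨f₂, h₂⟩ ⟨g₁, hg₁, hf₁, hh₁⟩ ⟨g₂, hg₂, hf₂, hh₂⟩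
    refine ⟨g₁ + g₂, fun a b => (hg₁ a b).add (hg₂ a b), (Lp.coeFn_add _ _).trans (hf₁.add hf₂), ?_⟩
    filter_upwards [Lp.coeFn_add h₁ h₂, hh₁, hh₂,
      (weight_ac_volume c).ae_le hg₁.ae_differentiableAt,
      (weight_ac_volume c).ae_le hg₂.ae_differentiableAt] with t e e₁ e₂ d₁ d₂
    change (h₁ + h₂ : Hc c) t = _
    rw [e, Pi.add_apply, e₁, e₂, deriv_add d₁ d₂]
  smul_mem' := by
    rintro k ⟨f, h⟩ ⟨g, hg, hf, hh⟩
    refine ⟨k • g, fun a b => (hg a b).const_smul k, (Lp.coeFn_smul _ _).trans (hf.const_smul k), ?_⟩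
    filter_upwards [Lp.coeFn_smul k h, hh,
      (weight_ac_volume c).ae_le hg.ae_differentiableAt] with t e e₁ d
    change (k • h : Hc c) t = _
    rw [e, Pi.smul_apply, e₁, deriv_const_smul k d]

theorem shiftGraph_functional (c : ℝ) (p : Hc c × Hc c) (hp : p ∈ shiftGraph c) (h0 : p.1 = 0) :
    p.2 = 0 := by
  obtain ⟨g, hg, hf, hh⟩ := hp
  have hg0 : g = fun _ => 0 := by
    refine (hg.continuous.ae_eq_iff_eq (μ := (volume : Measure ℝ)) continuous_const).1 ?_
    refine (volume_ac_weight c).ae_le ?_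
    rw [h0] at hf
    exact hf.symm.trans (Lp.coeFn_zero _ _ _)
  rw [Lp.eq_zero_iff_ae_eq_zero]
  refine hh.trans ?_
  rw [hg0]
  filter_upwards with t
  simp

/-- The infinitesimal shift `f ↦ f'` on `L²(ℝ, e^{-2ct} dt)`, with domain the set of those `f` that
are locally absolutely continuous with `f'` again in the space. -/
def infinitesimalShift (c : ℝ) : Hc c →ₗ.[ℂ] Hc c := (shiftGraph c).toLinearPMap

theorem mem_infinitesimalShift_graph (c : ℝ) (f h : Hc c) :
    (f, h) ∈ (infinitesimalShift c).graph ↔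
      ∃ g : ℝ → ℂ, IsAC g ∧ f =ᵐ[weight c] g ∧ h =ᵐ[weight c] deriv g := by
  rw [infinitesimalShift, Submodule.toLinearPMap_graph_eq _ (shiftGraph_functional c)]
  rfl

/-- The spectral operator `ζ(∂_c)`. -/
def spectralOperator (c : ℝ) : Hc c →ₗ.[ℂ] Hc c :=
  functionalCalculus (infinitesimalShift c) riemannZeta

/-- The vertical line `Re s = c`, without the pole of `ζ` (which lies on it only for `c = 1`). -/
def verticalLine (c : ℝ) : Set ℂ := {s | s.re = c ∧ s ≠ 1}

end SpectralOp

end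

/-!
Multiplication by `e^{-ct}` maps `L²(ℝ, e^{-2ct} dt)` unitarily onto `L²(ℝ)` and turns `∂_c` into
`d/dt + c`, which the Fourier transform turns into multiplication by `c + 2πiξ`. The functional
calculus of a multiplication operator is composition, so `ζ(∂_c)` is unitarily equivalent to
multiplication by `ξ ↦ ζ(c + 2πiξ)`, and such an operator is invertible exactly when its symbol is
essentially bounded away from `0`; by continuity of `ζ`, this is a statement about the values of `ζ`
on the whole line `Re s = c`.

Two points need work. The first is that `∂_c` has only one resolution of the identity: if two of
them integrate to the same operator, the projections of one onto a small disc and of the other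
onto a small distant disc have product `0`, whence the two agree on closed sets. The second is
that `∂_c` is not a proper extension of the multiplication operator: the multiplication operator
minus `c + 1` is onto, while `f' = (c + 1) f` has no nonzero solution in the weighted space.
-/

noncomputable section

namespace SpectralOp

open Complex Filter Set Topology
open scoped ENNReal NNReal

section QuadraticForm

variable {V H : Type*} [AddCommGroup V] [Module ℂ V] [NormedAddCommGroup H] [InnerProductSpace ℂ H]

theorem four_mul_inner_eq_polarization (S T : V →ₗ[ℂ] H) (x y : V) :
    4 * inner ℂ (S y) (T x) =
      (inner ℂ (S (x + y)) (T (x + y)) - inner ℂ (S (x - y)) (T (x - y))) +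
      I * (inner ℂ (S (x + I • y)) (T (x + I • y)) - inner ℂ (S (x - I • y)) (T (x - I • y))) := by
  simp only [map_add, map_sub, map_smul, inner_add_left, inner_add_right, inner_sub_left,
    inner_sub_right, inner_smul_left, inner_smul_right, conj_I]
  ring_nf
  simp only [I_sq]
  ring

theorem norm_inner_le_of_norm_inner_self_le {S T : V →ₗ[ℂ] H} {r : ℝ}
    (h : ∀ x, ‖inner ℂ (S x) (T x)‖ ≤ r * ‖S x‖ ^ 2) (x y : V) :
    ‖inner ℂ (S y) (T x)‖ ≤ r * (‖S x‖ ^ 2 + ‖S y‖ ^ 2) := by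
  have parallelogram (z : V) :
      r * ‖S (x + z)‖ ^ 2 + r * ‖S (x - z)‖ ^ 2 = 2 * r * (‖S x‖ ^ 2 + ‖S z‖ ^ 2) := by
    rw [map_add, map_sub]
    linear_combination r * parallelogram_law_with_norm ℂ (S x) (S z)
  have norm_I_smul : ‖S (I • y)‖ = ‖S y‖ := by rw [map_smul, norm_smul, norm_I, one_mul]
  have bound (z : V) :
      ‖inner ℂ (S (x + z)) (T (x + z)) - inner ℂ (S (x - z)) (T (x - z))‖ ≤
        2 * r * (‖S x‖ ^ 2 + ‖S z‖ ^ 2) :=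
    (norm_sub_le_of_le (h _) (h _)).trans_eq (parallelogram z)
  have norm_I_mul (w : ℂ) : ‖I * w‖ = ‖w‖ := by rw [norm_mul, norm_I, one_mul]
  have key := norm_add_le_of_le (bound y) ((norm_I_mul _).trans_le (bound (I • y)))
  rw [← four_mul_inner_eq_polarization, norm_mul, norm_I_smul, norm_ofNat] at key
  linarith

theorem norm_apply_le_of_norm_inner_self_le {T : H →ₗ[ℂ] H} {r : ℝ} (hr : 0 ≤ r)
    (h : ∀ x, ‖inner ℂ x (T x)‖ ≤ r * ‖x‖ ^ 2) (x : H) : ‖T x‖ ≤ 2 * r * ‖x‖ := by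
  have key (t : ℝ) : 0 ≤ r * ‖x‖ ^ 2 * (t * t) + -‖T x‖ ^ 2 * t + r * ‖T x‖ ^ 2 := by
    have := norm_inner_le_of_norm_inner_self_le (S := LinearMap.id) h ((t : ℂ) • x) (T x)
    simp only [LinearMap.id_apply, map_smul, inner_smul_right, norm_mul, norm_real, norm_smul,
      inner_self_eq_norm_sq_to_K, norm_pow, coe_algebraMap, Real.norm_eq_abs, mul_pow,
      sq_abs] at this
    nlinarith [le_abs_self t, sq_nonneg ‖T x‖]
  have hdiscrim := discrim_le_zero key
  rcases (norm_nonneg (T x)).eq_or_lt' with h0 | h0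
  · rw [h0]
    positivity
  · refine le_of_sq_le_sq ?_ (by positivity)
    rw [discrim] at hdiscrim
    nlinarith [sq_pos_of_pos h0]

theorem eq_zero_of_inner_self_eq_zero {D : Submodule ℂ H} (hD : Dense (D : Set H))
    {T : D →ₗ[ℂ] H} (h : ∀ x : D, inner ℂ (x : H) (T x) = 0) : T = 0 := by
  ext x
  refine hD.eq_zero_of_inner_right ℂ fun y hy => ?_
  simpa using norm_inner_le_of_norm_inner_self_le (S := D.subtype) (T := T) (r := 0)
    (fun x => by simp [h]) x ⟨y, hy⟩

theorem linearPMap_ext_of_inner_self {A B : H →ₗ.[ℂ] H} (hA : Dense (A.domain : Set H))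
    (hdom : A.domain = B.domain)
    (h : ∀ (x : H) (hx : x ∈ A.domain) (hx' : x ∈ B.domain),
      inner ℂ x (A ⟨x, hx⟩) = inner ℂ x (B ⟨x, hx'⟩)) : A = B := by
  have hsub : A.toFun - B.toFun ∘ₗ Submodule.inclusion hdom.le = 0 :=
    eq_zero_of_inner_self_eq_zero hA fun x => by
      rw [LinearMap.sub_apply, inner_sub_right, sub_eq_zero]
      exact h x x.2 (hdom.le x.2)
  exact LinearPMap.ext hdom fun x hx _ => sub_eq_zero.1 (LinearMap.congr_fun hsub ⟨x, hx⟩)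

end QuadraticForm

namespace ResolutionOfIdentity

variable {H : Type*} [NormedAddCommGroup H] [InnerProductSpace ℂ H] [CompleteSpace H]
  {E E' : ResolutionOfIdentity H} {s t : Set ℂ}

theorem proj_proj (E : ResolutionOfIdentity H) (hs : MeasurableSet s) (ht : MeasurableSet t)
    (x : H) : E.proj s (E.proj t x) = E.proj (s ∩ t) x := by
  rw [E.proj_inter s t hs ht, mul_apply_eq_comp]

theorem proj_proj_self (E : ResolutionOfIdentity H) (hs : MeasurableSet s) (x : H) :
    E.proj s (E.proj s x) = E.proj s x := by
  rw [E.proj_proj hs hs, inter_self]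

theorem proj_comm (E : ResolutionOfIdentity H) (hs : MeasurableSet s) (ht : MeasurableSet t)
    (x : H) : E.proj s (E.proj t x) = E.proj t (E.proj s x) := by
  rw [E.proj_proj hs ht, E.proj_proj ht hs, inter_comm]

theorem inner_proj_left (E : ResolutionOfIdentity H) (hs : MeasurableSet s) (x y : H) :
    inner ℂ (E.proj s x) y = inner ℂ x (E.proj s y) :=
  ContinuousLinearMap.isSelfAdjoint_iff_isSymmetric.1 (E.isStarProjection s hs).isSelfAdjoint x y

theorem norm_proj_apply_le (E : ResolutionOfIdentity H) (hs : MeasurableSet s) (x : H) :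
    ‖E.proj s x‖ ≤ ‖x‖ :=
  ((E.proj s).le_of_opNorm_le (E.isStarProjection s hs).norm_le x).trans_eq (one_mul _)

/-- The `H`-valued measure `s ↦ E(s) x`. -/
def vectorMeasure (E : ResolutionOfIdentity H) (x : H) : VectorMeasure ℂ H where
  measureOf' s := E.proj s x
  empty' := E.proj_empty x
  not_measurable' s hs := by rw [E.proj_of_not_measurable s hs, zero_apply]
  m_iUnion' s hs hd := E.hasSum_iUnion s hs hd x

theorem proj_compl (E : ResolutionOfIdentity H) (hs : MeasurableSet s) (x : H) :
    E.proj sᶜ x = x - E.proj s x := by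
  have h : E.proj sᶜ x = E.proj univ x - E.proj s x := (E.vectorMeasure x).of_compl hs
  rwa [E.proj_univ, one_apply_eq_self] at h

theorem eq_of_proj_eq_of_isClosed (h : ∀ F, IsClosed F → E.proj F = E'.proj F) : E = E' := by
  have hproj : E.proj = E'.proj := by
    ext s x
    have hvec : E.vectorMeasure x = E'.vectorMeasure x :=
      VectorMeasure.ext_of_generateFrom _ (fun F hF => DFunLike.congr_fun (h F hF) x)
        (BorelSpace.measurable_eq.trans borel_eq_generateFrom_isClosed) isPiSystem_isClosed
        (DFunLike.congr_fun (h univ isClosed_univ) x)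
    exact DFunLike.congr_fun hvec s
  cases E
  cases E'
  congr

theorem scalarMeasure_apply (E : ResolutionOfIdentity H) (x : H) (hs : MeasurableSet s) :
    E.scalarMeasure x s = ENNReal.ofReal (‖E.proj s x‖ ^ 2) := by
  rw [scalarMeasure, Measure.ofMeasurable_apply s hs, ← E.proj_proj_self hs x,
    ← E.inner_proj_left hs, E.proj_proj_self hs]
  exact congrArg _ (inner_self_eq_norm_sq (𝕜 := ℂ) _)

theorem scalarMeasure_univ (E : ResolutionOfIdentity H) (x : H) :
    E.scalarMeasure x univ = ENNReal.ofReal (‖x‖ ^ 2) := by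
  rw [E.scalarMeasure_apply x MeasurableSet.univ, E.proj_univ, one_apply_eq_self]

instance isFiniteMeasure_scalarMeasure (x : H) : IsFiniteMeasure (E.scalarMeasure x) :=
  ⟨(E.scalarMeasure_univ x).trans_lt ENNReal.ofReal_lt_top⟩

theorem scalarMeasure_real (E : ResolutionOfIdentity H) (x : H) (hs : MeasurableSet s) :
    (E.scalarMeasure x).real s = ‖E.proj s x‖ ^ 2 := by
  rw [measureReal_def, E.scalarMeasure_apply x hs, ENNReal.toReal_ofReal (sq_nonneg _)]

theorem scalarMeasure_eq_zero_iff (E : ResolutionOfIdentity H) (x : H) (hs : MeasurableSet s) :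
    E.scalarMeasure x s = 0 ↔ E.proj s x = 0 := by
  rw [← measureReal_eq_zero_iff, E.scalarMeasure_real x hs, sq_eq_zero_iff, norm_eq_zero]

theorem scalarMeasure_proj (E : ResolutionOfIdentity H) (x : H) (ht : MeasurableSet t) :
    E.scalarMeasure (E.proj t x) = (E.scalarMeasure x).restrict t := by
  ext s hs
  rw [Measure.restrict_apply hs, E.scalarMeasure_apply _ hs, E.scalarMeasure_apply _ (hs.inter ht),
    E.proj_proj hs ht]

/-- The unitary reflection `2 E(t) - 1`, which fixes the range of `E(t)`. -/
def reflection (E : ResolutionOfIdentity H) (t : Set ℂ) : H →L[ℂ] H := 2 * E.proj t - 1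

theorem reflection_apply (E : ResolutionOfIdentity H) (t : Set ℂ) (x : H) :
    E.reflection t x = (2 : ℂ) • E.proj t x - x := by
  simp [reflection, two_mul, two_smul]

theorem scalarMeasure_reflection (E : ResolutionOfIdentity H) (x : H) (ht : MeasurableSet t) :
    E.scalarMeasure (E.reflection t x) = E.scalarMeasure x := by
  ext s hs
  have hcomm : E.proj s (E.reflection t x) = E.reflection t (E.proj s x) := by
    rw [reflection_apply, reflection_apply, map_sub, map_smul, E.proj_comm hs ht]
  rw [E.scalarMeasure_apply _ hs, E.scalarMeasure_apply _ hs, hcomm, reflection,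
    ContinuousLinearMap.norm_map_of_mem_unitary
      (E.isStarProjection t ht).two_mul_sub_one_mem_unitary]

theorem inner_reflection_right (E : ResolutionOfIdentity H) (ht : MeasurableSet t) (x y : H) :
    inner ℂ x (E.reflection t y) = inner ℂ (E.reflection t x) y := by
  rw [reflection_apply, reflection_apply, inner_sub_left, inner_sub_right, inner_smul_left,
    inner_smul_right, E.inner_proj_left ht, map_ofNat]

theorem reflection_reflection (E : ResolutionOfIdentity H) (ht : MeasurableSet t) (x : H) :
    E.reflection t (E.reflection t x) = x := by
  rw [reflection_apply, reflection_apply, map_sub, map_smul, E.proj_proj_self ht, two_smul,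
    two_smul]
  abel

section IsIntegral

variable {φ : ℂ → ℂ} {A B : H →ₗ.[ℂ] H}

theorem IsIntegral.mem_domain_of_scalarMeasure_eq (hA : E.IsIntegral φ A) {x y : H}
    (h : E.scalarMeasure x = E.scalarMeasure y) (hy : y ∈ A.domain) : x ∈ A.domain := by
  rwa [hA.1, h, ← hA.1]

theorem IsIntegral.proj_mem_domain (hA : E.IsIntegral φ A) (ht : MeasurableSet t) {x : H}
    (hx : x ∈ A.domain) : E.proj t x ∈ A.domain := by
  rw [hA.1, E.scalarMeasure_proj x ht]
  exact ((hA.1 x).1 hx).restrict t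

theorem IsIntegral.proj_mem_domain_of_bound (hA : E.IsIntegral φ A) (hφ : Measurable φ)
    (ht : MeasurableSet t) {C : ℝ} (hC : ∀ w ∈ t, ‖φ w‖ ≤ C) (x : H) :
    E.proj t x ∈ A.domain := by
  rw [hA.1, E.scalarMeasure_proj x ht]
  exact MemLp.of_bound hφ.aestronglyMeasurable C (ae_restrict_of_forall_mem ht hC)

theorem IsIntegral.dense_domain (hA : E.IsIntegral φ A) (hφ : Measurable φ) :
    Dense (A.domain : Set H) := by
  intro x
  let level (n : ℕ) : Set ℂ := (fun w => ⌊‖φ w‖⌋₊) ⁻¹' {n}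
  have hlevel (n : ℕ) : MeasurableSet (level n) :=
    (Nat.measurable_floor.comp hφ.norm) (measurableSet_singleton n)
  have hsum : HasSum (fun n => E.proj (level n) x) x := by
    have h := E.hasSum_iUnion level hlevel (pairwise_disjoint_fiber _) x
    rwa [← preimage_iUnion, iUnion_of_singleton, preimage_univ, E.proj_univ, one_apply_eq_self] at h
  refine mem_closure_of_tendsto hsum (Eventually.of_forall fun s => sum_mem fun n _ => ?_)
  refine hA.proj_mem_domain_of_bound hφ (hlevel n) (C := n + 1) (fun w hw => ?_) x
  rw [← (hw : ⌊‖φ w‖⌋₊ = n)]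
  exact (Nat.lt_floor_add_one _).le

theorem IsIntegral.unique (hA : E.IsIntegral φ A) (hB : E.IsIntegral φ B) (hφ : Measurable φ) :
    A = B :=
  linearPMap_ext_of_inner_self (hA.dense_domain hφ)
    (Submodule.ext fun x => (hA.1 x).trans (hB.1 x).symm)
    fun x hx hx' => (hA.2 ⟨x, hx⟩).trans (hB.2 ⟨x, hx'⟩).symm

-- `2 E(t) - 1` leaves the quadratic form of `A` invariant, hence commutes with `A`.
theorem IsIntegral.apply_reflection (hA : E.IsIntegral φ A) (hφ : Measurable φ)
    (ht : MeasurableSet t) {x : H} (hx : x ∈ A.domain) (hx' : E.reflection t x ∈ A.domain) :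
    A ⟨E.reflection t x, hx'⟩ = E.reflection t (A ⟨x, hx⟩) := by
  have hmem (y : A.domain) : E.reflection t y ∈ A.domain :=
    hA.mem_domain_of_scalarMeasure_eq (E.scalarMeasure_reflection _ ht) y.2
  let U : A.domain →ₗ[ℂ] A.domain :=
    ((E.reflection t).toLinearMap ∘ₗ A.domain.subtype).codRestrict A.domain hmem
  have hform : (E.reflection t).toLinearMap ∘ₗ A.toFun ∘ₗ U - A.toFun = 0 := by
    refine eq_zero_of_inner_self_eq_zero (hA.dense_domain hφ) fun y => ?_
    have h := hA.2 ⟨E.reflection t y, hmem y⟩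
    rw [E.scalarMeasure_reflection _ ht, ← hA.2 y, ← E.inner_reflection_right ht] at h
    rw [LinearMap.sub_apply, inner_sub_right, sub_eq_zero]
    exact h
  have h : E.reflection t (A ⟨E.reflection t x, hx'⟩) = A ⟨x, hx⟩ :=
    sub_eq_zero.1 (LinearMap.congr_fun hform ⟨x, hx⟩)
  rw [← h, E.reflection_reflection ht]

theorem IsIntegral.apply_proj (hA : E.IsIntegral φ A) (hφ : Measurable φ)
    (ht : MeasurableSet t) {x : H} (hx : x ∈ A.domain) (hx' : E.proj t x ∈ A.domain) :
    A ⟨E.proj t x, hx'⟩ = E.proj t (A ⟨x, hx⟩) := by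
  have hr : E.reflection t x ∈ A.domain := by
    rw [reflection_apply]
    exact A.domain.sub_mem (A.domain.smul_mem 2 hx') hx
  have h := hA.apply_reflection hφ ht hx hr
  have hsplit : A ⟨E.reflection t x, hr⟩ = (2 : ℂ) • A ⟨E.proj t x, hx'⟩ - A ⟨x, hx⟩ := by
    rw [← A.map_smul, ← A.map_sub]
    exact congrArg A (Subtype.ext (E.reflection_apply t x))
  rw [hsplit, reflection_apply, sub_left_inj] at h
  exact smul_right_injective H two_ne_zero h

theorem IsIntegral.proj_apply_proj (hA : E.IsIntegral φ A) (hφ : Measurable φ)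
    (ht : MeasurableSet t) {x : H} (hx : E.proj t x ∈ A.domain) :
    E.proj t (A ⟨E.proj t x, hx⟩) = A ⟨E.proj t x, hx⟩ := by
  rw [← hA.apply_proj hφ ht hx (hA.proj_mem_domain ht hx)]
  simp only [E.proj_proj_self ht]

theorem IsIntegral.norm_inner_apply_sub_smul_le (hA : E.IsIntegral φ A) {a : ℂ} {r : ℝ}
    (x : A.domain) (h : ∀ᵐ w ∂E.scalarMeasure (x : H), ‖φ w - a‖ ≤ r) :
    ‖inner ℂ (x : H) (A x - a • (x : H))‖ ≤ r * ‖(x : H)‖ ^ 2 := by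
  have hreal : (E.scalarMeasure (x : H)).real univ = ‖(x : H)‖ ^ 2 := by
    rw [E.scalarMeasure_real _ MeasurableSet.univ, E.proj_univ, one_apply_eq_self]
  have hint : inner ℂ (x : H) (A x - a • (x : H)) = ∫ w, (φ w - a) ∂E.scalarMeasure (x : H) := by
    have hφ : Integrable φ (E.scalarMeasure (x : H)) :=
      ((hA.1 x).1 x.2).integrable one_le_two
    rw [integral_sub hφ (integrable_const a), integral_const, hreal, inner_sub_right, hA.2,
      inner_smul_right, inner_self_eq_norm_sq_to_K, real_smul, mul_comm, ofReal_pow]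
    rfl
  rw [hint, ← hreal]
  exact norm_integral_le_of_norm_le_const h

theorem IsIntegral.norm_apply_proj_sub_smul_le (hA : E.IsIntegral φ A) (hφ : Measurable φ)
    (ht : MeasurableSet t) {a : ℂ} {r : ℝ} (hr : 0 ≤ r) (h : ∀ w ∈ t, ‖φ w - a‖ ≤ r) {x : H}
    (hx : E.proj t x ∈ A.domain) :
    ‖A ⟨E.proj t x, hx⟩ - a • E.proj t x‖ ≤ 2 * r * ‖E.proj t x‖ := by
  have hmem (y : H) : E.proj t y ∈ A.domain :=
    hA.proj_mem_domain_of_bound hφ ht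
      (fun w hw => (norm_le_norm_add_norm_sub' _ a).trans (add_le_add_right (h w hw) _)) y
  let T : H →ₗ[ℂ] H := A.toFun ∘ₗ (E.proj t).toLinearMap.codRestrict A.domain hmem -
    a • (E.proj t).toLinearMap
  have hT (y : H) : T y = A ⟨E.proj t y, hmem y⟩ - a • E.proj t y := rfl
  have proj_hT (y : H) : E.proj t (T y) = T y := by
    rw [hT, map_sub, map_smul, hA.proj_apply_proj hφ ht, E.proj_proj_self ht]
  have hform (y : H) : ‖inner ℂ y (T y)‖ ≤ r * ‖y‖ ^ 2 := by
    have hae : ∀ᵐ w ∂E.scalarMeasure (E.proj t y), ‖φ w - a‖ ≤ r := by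
      rw [E.scalarMeasure_proj y ht]
      exact ae_restrict_of_forall_mem ht h
    rw [← proj_hT, ← E.inner_proj_left ht]
    refine (hA.norm_inner_apply_sub_smul_le ⟨_, hmem y⟩ hae).trans ?_
    gcongr
    exact E.norm_proj_apply_le ht y
  have key := norm_apply_le_of_norm_inner_self_le hr hform (E.proj t x)
  simpa only [hT, E.proj_proj_self ht] using key

end IsIntegral

section Uniqueness

variable {N : H →ₗ.[ℂ] H}

-- Let `P`, `Q` be the two projections. On the range of `Q P`, `(a - b) v = (N v - b v) -
-- Q (N u - a u)` where `v = Q u`, `u = P x`.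
theorem IsIntegral.norm_proj_mul_proj_apply_mul_dist_le (hE : E.IsIntegral (fun w => w) N)
    (hE' : E'.IsIntegral (fun w => w) N) (a b : ℂ) {r : ℝ} (hr : 0 ≤ r) (x : H) :
    ‖(E'.proj (Metric.closedBall b r) * E.proj (Metric.closedBall a r)) x‖ * dist a b ≤
      4 * r * ‖E'.proj (Metric.closedBall b r) * E.proj (Metric.closedBall a r)‖ * ‖x‖ := by
  set P := E.proj (Metric.closedBall a r)
  set Q := E'.proj (Metric.closedBall b r)
  have hball (c : ℂ) : MeasurableSet (Metric.closedBall c r) :=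
    Metric.isClosed_closedBall.measurableSet
  have hnear (c : ℂ) : ∀ w ∈ Metric.closedBall c r, ‖w - c‖ ≤ r := fun w hw => by
    rwa [mem_closedBall_iff_norm] at hw
  have hbound : ∀ w ∈ Metric.closedBall a r, ‖w‖ ≤ ‖a‖ + r := fun w hw =>
    (norm_le_norm_add_norm_sub' w a).trans (add_le_add_right (hnear a w hw) _)
  have hu : P x ∈ N.domain := hE.proj_mem_domain_of_bound measurable_id (hball a) hbound x
  have hv : Q (P x) ∈ N.domain := hE'.proj_mem_domain (hball b) hu
  have hNu : ‖(Q * P) (N ⟨P x, hu⟩ - a • P x)‖ ≤ ‖Q * P‖ * (2 * r * ‖x‖) :=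
    (Q * P).le_opNorm_of_le <|
      (hE.norm_apply_proj_sub_smul_le measurable_id (hball a) hr (hnear a) hu).trans <| by
        gcongr
        exact E.norm_proj_apply_le (hball a) x
  have hNv : ‖N ⟨Q (P x), hv⟩ - b • Q (P x)‖ ≤ 2 * r * (‖Q * P‖ * ‖x‖) :=
    (hE'.norm_apply_proj_sub_smul_le measurable_id (hball b) hr (hnear b) hv).trans <| by
      gcongr
      exact (Q * P).le_opNorm x
  have hsub : (a - b) • (Q * P) x =
      (N ⟨Q (P x), hv⟩ - b • Q (P x)) - (Q * P) (N ⟨P x, hu⟩ - a • P x) := by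
    rw [hE'.apply_proj measurable_id (hball b) hu hv, mul_apply_eq_comp, mul_apply_eq_comp,
      map_sub, map_smul, hE.proj_apply_proj measurable_id (hball a) hu,
      E.proj_proj_self (hball a), map_sub, map_smul, sub_smul]
    abel
  calc ‖(Q * P) x‖ * dist a b = ‖(a - b) • (Q * P) x‖ := by
        rw [norm_smul, dist_eq_norm, mul_comm]
    _ ≤ 2 * r * (‖Q * P‖ * ‖x‖) + ‖Q * P‖ * (2 * r * ‖x‖) := hsub ▸ norm_sub_le_of_le hNv hNu
    _ = 4 * r * ‖Q * P‖ * ‖x‖ := by ring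

theorem IsIntegral.proj_closedBall_mul_eq_zero (hE : E.IsIntegral (fun w => w) N)
    (hE' : E'.IsIntegral (fun w => w) N) {a b : ℂ} {r : ℝ} (hr : 0 ≤ r) (hab : 4 * r < dist a b) :
    E'.proj (Metric.closedBall b r) * E.proj (Metric.closedBall a r) = 0 := by
  set R := E'.proj (Metric.closedBall b r) * E.proj (Metric.closedBall a r)
  have hdist : 0 < dist a b := (by positivity : 0 ≤ 4 * r).trans_lt hab
  have hle : ‖R‖ ≤ 4 * r * ‖R‖ / dist a b :=
    R.opNorm_le_bound (by positivity) fun x => by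
      rw [div_mul_eq_mul_div, le_div_iff₀ hdist]
      exact hE.norm_proj_mul_proj_apply_mul_dist_le hE' a b hr x
  rw [le_div_iff₀ hdist, mul_comm] at hle
  by_contra h
  exact absurd (le_of_mul_le_mul_right hle (norm_pos_iff.2 h)) hab.not_ge

theorem proj_mul_eq_zero_comm (hs : MeasurableSet s) (ht : MeasurableSet t)
    (h : E.proj s * E'.proj t = 0) : E'.proj t * E.proj s = 0 := by
  simpa only [star_mul, star_zero, (E.isStarProjection s hs).isSelfAdjoint.star_eq,
    (E'.isStarProjection t ht).isSelfAdjoint.star_eq] using congrArg star h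

theorem proj_mul_eq_zero_of_locally (T : H →L[ℂ] H) (hs : MeasurableSet s)
    (h : ∀ a ∈ s, ∃ t ∈ 𝓝[s] a, MeasurableSet t ∧ E.proj t * T = 0) : E.proj s * T = 0 := by
  ext x
  refine (E.scalarMeasure_eq_zero_iff (T x) hs).1 (measure_null_of_locally_null s fun a ha => ?_)
  obtain ⟨t, hta, ht, htT⟩ := h a ha
  exact ⟨t, hta, (E.scalarMeasure_eq_zero_iff (T x) ht).2 (DFunLike.congr_fun htT x)⟩

theorem IsIntegral.proj_compl_mul_proj_eq_zero (hE : E.IsIntegral (fun w => w) N)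
    (hE' : E'.IsIntegral (fun w => w) N) {F : Set ℂ} (hF : IsClosed F) :
    E'.proj Fᶜ * E.proj F = 0 := by
  refine proj_mul_eq_zero_of_locally _ hF.measurableSet.compl fun b hb => ?_
  obtain ⟨ε, hε, hball⟩ := Metric.isOpen_iff.1 hF.isOpen_compl b hb
  refine ⟨Metric.closedBall b (ε / 5), mem_nhdsWithin_of_mem_nhds
    (Metric.closedBall_mem_nhds b (by positivity)), Metric.isClosed_closedBall.measurableSet,
    proj_mul_eq_zero_comm hF.measurableSet Metric.isClosed_closedBall.measurableSet ?_⟩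
  refine proj_mul_eq_zero_of_locally _ hF.measurableSet fun a ha => ?_
  have hab : ε ≤ dist b a := by
    rw [dist_comm]
    exact not_lt.1 fun h => hball h ha
  exact ⟨Metric.closedBall a (ε / 5), mem_nhdsWithin_of_mem_nhds
    (Metric.closedBall_mem_nhds a (by positivity)), Metric.isClosed_closedBall.measurableSet,
    hE'.proj_closedBall_mul_eq_zero hE (by positivity) (by linarith)⟩

theorem IsIntegral.proj_mul_proj (hE : E.IsIntegral (fun w => w) N)
    (hE' : E'.IsIntegral (fun w => w) N) {F : Set ℂ} (hF : IsClosed F) :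
    E'.proj F * E.proj F = E.proj F := by
  ext x
  have h : E'.proj Fᶜ (E.proj F x) = 0 :=
    DFunLike.congr_fun (hE.proj_compl_mul_proj_eq_zero hE' hF) x
  rw [E'.proj_compl hF.measurableSet, sub_eq_zero] at h
  exact h.symm

theorem IsIntegral.resolution_unique (hE : E.IsIntegral (fun w => w) N)
    (hE' : E'.IsIntegral (fun w => w) N) : E = E' := by
  refine eq_of_proj_eq_of_isClosed fun F hF => ?_
  have h := congrArg star (hE.proj_mul_proj hE' hF)
  rw [star_mul, (E.isStarProjection F hF.measurableSet).isSelfAdjoint.star_eq,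
    (E'.isStarProjection F hF.measurableSet).isSelfAdjoint.star_eq,
    hE'.proj_mul_proj hE hF] at h
  exact h.symm

end Uniqueness

end ResolutionOfIdentity

theorem IsFunctionOf.unique {H : Type*} [NormedAddCommGroup H] [InnerProductSpace ℂ H]
    [CompleteSpace H] {N A B : H →ₗ.[ℂ] H} {φ : ℂ → ℂ} (hφ : Measurable φ)
    (hA : IsFunctionOf N φ A) (hB : IsFunctionOf N φ B) : A = B := by
  obtain ⟨E, hEN, hEA⟩ := hA
  obtain ⟨E', hEN', hEB⟩ := hB
  obtain rfl := hEN.resolution_unique hEN'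
  exact hEA.unique hEB hφ

theorem IsFunctionOf.functionalCalculus_eq {H : Type*} [NormedAddCommGroup H]
    [InnerProductSpace ℂ H] [CompleteSpace H] {N A : H →ₗ.[ℂ] H} {φ : ℂ → ℂ} (hφ : Measurable φ)
    (hA : IsFunctionOf N φ A) : functionalCalculus N φ = A := by
  have h : ∃ A, IsFunctionOf N φ A := ⟨A, hA⟩
  rw [functionalCalculus, dif_pos h]
  exact h.choose_spec.unique hφ hA

section UnitaryEquivalence

variable {H K : Type*} [NormedAddCommGroup H] [InnerProductSpace ℂ H]
  [NormedAddCommGroup K] [InnerProductSpace ℂ K] (V : H ≃ₗᵢ[ℂ] K)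

/-- The operator `V⁻¹ A V` unitarily equivalent to the possibly unbounded operator `A`; its domain
is the preimage under `V` of the domain of `A`. -/
def unitaryConj (A : K →ₗ.[ℂ] K) : H →ₗ.[ℂ] H where
  domain := A.domain.comap V.toLinearMap
  toFun := V.symm.toLinearMap ∘ₗ A.toFun ∘ₗ V.toLinearMap.restrict fun _ hx => hx

theorem mem_unitaryConj_domain {A : K →ₗ.[ℂ] K} {x : H} :
    x ∈ (unitaryConj V A).domain ↔ V x ∈ A.domain := Iff.rfl

theorem map_unitaryConj_apply (A : K →ₗ.[ℂ] K) (x : (unitaryConj V A).domain) :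
    V (unitaryConj V A x) = A ⟨V x, x.2⟩ := V.apply_symm_apply _

theorem unitaryConj_symm_unitaryConj (A : K →ₗ.[ℂ] K) :
    unitaryConj V.symm (unitaryConj V A) = A := by
  refine LinearPMap.ext (Submodule.ext fun x => ?_) fun x hx hx' => ?_
  · rw [mem_unitaryConj_domain, mem_unitaryConj_domain, V.apply_symm_apply]
  · refine (map_unitaryConj_apply V A ⟨V.symm x, hx⟩).trans ?_
    congr 1
    exact Subtype.ext (V.apply_symm_apply x)

theorem IsInvertible.unitaryConj {A : K →ₗ.[ℂ] K} (hA : IsInvertible A) :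
    IsInvertible (unitaryConj V A) := by
  obtain ⟨B, hrange, hright, hleft⟩ := hA
  have hB : ∀ y, B y ∈ A.domain := fun y => hrange.subset ⟨y, rfl⟩
  refine ⟨V.symm.toContinuousLinearEquiv.toContinuousLinearMap ∘L B ∘L
    V.toContinuousLinearEquiv.toContinuousLinearMap, ?_, fun u hu => V.injective ?_,
    fun v => V.injective ?_⟩
  · refine Subset.antisymm (range_subset_iff.2 fun u => ?_) fun v hv => ?_
    · change V (V.symm (B (V u))) ∈ A.domain
      simpa only [V.apply_symm_apply] using hB (V u)
    · obtain ⟨y, hy⟩ := hrange.superset hv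
      refine ⟨V.symm y, V.injective ?_⟩
      change V (V.symm (B (V (V.symm y)))) = V v
      rwa [V.apply_symm_apply, V.apply_symm_apply]
  · rw [map_unitaryConj_apply, ← hright (V u) (hB _)]
    congr 1
    exact Subtype.ext (V.apply_symm_apply _)
  · change V (V.symm (B (V (SpectralOp.unitaryConj V A v)))) = V v
    rw [V.apply_symm_apply, map_unitaryConj_apply, hleft]

theorem isInvertible_unitaryConj_iff {A : K →ₗ.[ℂ] K} :
    IsInvertible (unitaryConj V A) ↔ IsInvertible A :=
  ⟨fun h => unitaryConj_symm_unitaryConj V A ▸ h.unitaryConj V.symm, fun h => h.unitaryConj V⟩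

variable [CompleteSpace H] [CompleteSpace K]

/-- The resolution of the identity `s ↦ V⁻¹ E(s) V`. -/
def ResolutionOfIdentity.unitaryConj (E : ResolutionOfIdentity K) : ResolutionOfIdentity H where
  proj s := V.symm.conjStarAlgEquiv (E.proj s)
  isStarProjection s hs := (E.isStarProjection s hs).map V.symm.conjStarAlgEquiv
  proj_of_not_measurable s hs := by rw [E.proj_of_not_measurable s hs, map_zero]
  proj_univ := by rw [E.proj_univ, map_one]
  proj_inter s t hs ht := by rw [E.proj_inter s t hs ht, map_mul]
  hasSum_iUnion s hs hd x := (E.hasSum_iUnion s hs hd (V x)).mapL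
    V.symm.toContinuousLinearEquiv.toContinuousLinearMap

theorem ResolutionOfIdentity.scalarMeasure_unitaryConj (E : ResolutionOfIdentity K) (x : H) :
    (E.unitaryConj V).scalarMeasure x = E.scalarMeasure (V x) := by
  ext s hs
  rw [scalarMeasure_apply _ x hs, scalarMeasure_apply _ (V x) hs]
  exact congrArg (fun r => ENNReal.ofReal (r ^ 2)) (V.symm.norm_map (E.proj s (V x)))

variable {V}

theorem ResolutionOfIdentity.IsIntegral.unitaryConj {E : ResolutionOfIdentity K} {φ : ℂ → ℂ}
    {A : K →ₗ.[ℂ] K} (hA : E.IsIntegral φ A) :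
    (E.unitaryConj V).IsIntegral φ (SpectralOp.unitaryConj V A) := by
  refine ⟨fun x => ?_, fun x => ?_⟩
  · rw [mem_unitaryConj_domain, E.scalarMeasure_unitaryConj, hA.1]
  · rw [E.scalarMeasure_unitaryConj, ← hA.2 ⟨V x, x.2⟩, ← V.inner_map_map, map_unitaryConj_apply]

theorem IsFunctionOf.unitaryConj {N A : K →ₗ.[ℂ] K} {φ : ℂ → ℂ} (hA : IsFunctionOf N φ A) :
    IsFunctionOf (unitaryConj V N) φ (unitaryConj V A) := by
  obtain ⟨E, hEN, hEA⟩ := hA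
  exact ⟨E.unitaryConj V, hEN.unitaryConj, hEA.unitaryConj⟩

end UnitaryEquivalence

section SquareAdditive

variable {X G : Type*} [MeasurableSpace X] [NormedAddCommGroup G] {ν : Measure X}
  [IsFiniteMeasure ν] {m : Set X → G} {s : ℕ → Set X}

theorem sum_eq_apply_biUnion (hempty : m ∅ = 0)
    (hunion : ∀ s t, MeasurableSet s → MeasurableSet t → Disjoint s t → m (s ∪ t) = m s + m t)
    (hs : ∀ n, MeasurableSet (s n)) (hd : Pairwise (Function.onFun Disjoint s)) (F : Finset ℕ) :
    ∑ n ∈ F, m (s n) = m (⋃ n ∈ F, s n) := by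
  induction F using Finset.induction_on with
  | empty => simp [hempty]
  | insert a F ha ih =>
    rw [Finset.sum_insert ha, ih, Finset.set_biUnion_insert,
      hunion _ _ (hs a) (F.measurableSet_biUnion fun n _ => hs n)]
    exact disjoint_iUnion₂_right.2 fun n hn => hd (ne_of_mem_of_not_mem hn ha).symm

theorem hasSum_of_norm_sq_eq_measureReal
    (hunion : ∀ s t, MeasurableSet s → MeasurableSet t → Disjoint s t → m (s ∪ t) = m s + m t)
    (hnorm : ∀ s, MeasurableSet s → ‖m s‖ ^ 2 = ν.real s)
    (hs : ∀ n, MeasurableSet (s n)) (hd : Pairwise (Function.onFun Disjoint s)) :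
    HasSum (fun n => m (s n)) (m (⋃ n, s n)) := by
  have hU : MeasurableSet (⋃ n, s n) := .iUnion hs
  have hempty : m ∅ = 0 := by simpa using hnorm ∅ .empty
  have hdist (F : Finset ℕ) : ‖∑ n ∈ F, m (s n) - m (⋃ n, s n)‖ ^ 2 =
      ν.real (⋃ n, s n) - ∑ n ∈ F, ν.real (s n) := by
    have hF : MeasurableSet (⋃ n ∈ F, s n) := F.measurableSet_biUnion fun n _ => hs n
    have hsub : (⋃ n ∈ F, s n) ⊆ ⋃ n, s n := iUnion₂_subset fun n _ => subset_iUnion s n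
    have hsplit : m (⋃ n, s n) = m (⋃ n ∈ F, s n) + m ((⋃ n, s n) \ ⋃ n ∈ F, s n) := by
      rw [← hunion _ _ hF (hU.diff hF) disjoint_sdiff_right, union_sdiff_cancel hsub]
    rw [sum_eq_apply_biUnion hempty hunion hs hd, hsplit, sub_add_cancel_left, norm_neg,
      hnorm _ (hU.diff hF), measureReal_sdiff hsub hF,
      measureReal_biUnion_finset (fun i _ j _ hij => hd hij) fun n _ => hs n]
  have hν : HasSum (fun n => ν.real (s n)) (ν.real (⋃ n, s n)) := by
    simpa only [Measure.toSignedMeasure_apply_measurable, hs, hU] using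
      ν.toSignedMeasure.m_iUnion hs hd
  refine tendsto_iff_norm_sub_tendsto_zero.2 ?_
  have hsq := (tendsto_const_nhds (x := ν.real (⋃ n, s n))).sub hν
  simp only [← hdist, sub_self] at hsq
  simpa using hsq.sqrt

end SquareAdditive

section Multiplication

variable {X : Type*} [MeasurableSpace X] {μ : Measure X} {m : X → ℂ}

theorem mul_coeFn_add (m : X → ℂ) (f g : Lp ℂ 2 μ) :
    (fun t => m t * (f + g : Lp ℂ 2 μ) t) =ᵐ[μ] (fun t => m t * f t) + fun t => m t * g t := by
  filter_upwards [Lp.coeFn_add f g] with t ht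
  rw [ht, Pi.add_apply, Pi.add_apply, mul_add]

theorem mul_coeFn_smul (m : X → ℂ) (a : ℂ) (f : Lp ℂ 2 μ) :
    (fun t => m t * (a • f : Lp ℂ 2 μ) t) =ᵐ[μ] a • fun t => m t * f t := by
  filter_upwards [Lp.coeFn_smul a f] with t ht
  rw [ht, Pi.smul_apply, Pi.smul_apply, smul_eq_mul, smul_eq_mul, mul_left_comm]

variable (μ m) in
/-- The vectors `f` of `L²(μ)` for which `m f` is square-integrable. -/
def mulDomain : Submodule ℂ (Lp ℂ 2 μ) where
  carrier := {f | MemLp (fun t => m t * f t) 2 μ}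
  zero_mem' := by
    refine (memLp_congr_ae ?_).2 (MemLp.zero' (ε := ℂ))
    filter_upwards [Lp.coeFn_zero ℂ 2 μ] with t ht
    rw [ht, Pi.zero_apply, mul_zero]
  add_mem' {f g} hf hg := (memLp_congr_ae (mul_coeFn_add m f g)).2 (MemLp.add hf hg)
  smul_mem' a f hf := (memLp_congr_ae (mul_coeFn_smul m a f)).2 (MemLp.const_smul hf a)

theorem mem_mulDomain {f : Lp ℂ 2 μ} : f ∈ mulDomain μ m ↔ MemLp (fun t => m t * f t) 2 μ := Iff.rfl

variable (μ m) in
/-- The maximal operator of multiplication by `m` on `L²(μ)`. -/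
def mulOp : Lp ℂ 2 μ →ₗ.[ℂ] Lp ℂ 2 μ where
  domain := mulDomain μ m
  toFun :=
    { toFun f := MemLp.toLp _ (mem_mulDomain.1 f.2)
      map_add' f g := (MemLp.toLp_congr _ ((mem_mulDomain.1 f.2).add (mem_mulDomain.1 g.2))
        (mul_coeFn_add m (f : Lp ℂ 2 μ) (g : Lp ℂ 2 μ))).trans (MemLp.toLp_add _ _)
      map_smul' a f := (MemLp.toLp_congr _ ((mem_mulDomain.1 f.2).const_smul a)
        (mul_coeFn_smul m a (f : Lp ℂ 2 μ))).trans (MemLp.toLp_const_smul a _) }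

theorem mem_mulOp_domain {f : Lp ℂ 2 μ} :
    f ∈ (mulOp μ m).domain ↔ MemLp (fun t => m t * f t) 2 μ := Iff.rfl

theorem coeFn_mulOp (f : (mulOp μ m).domain) :
    mulOp μ m f =ᵐ[μ] fun t => m t * (f : Lp ℂ 2 μ) t := MemLp.coeFn_toLp f.2

theorem mem_mulOp_domain_of_ae {f g : Lp ℂ 2 μ} (h : g =ᵐ[μ] fun t => m t * f t) :
    f ∈ (mulOp μ m).domain :=
  (memLp_congr_ae h).1 (Lp.memLp g)

theorem mulOp_eq_of_ae {f : (mulOp μ m).domain} {g : Lp ℂ 2 μ}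
    (h : g =ᵐ[μ] fun t => m t * (f : Lp ℂ 2 μ) t) : mulOp μ m f = g :=
  Lp.ext ((coeFn_mulOp f).trans h.symm)

/-- Multiplication by an essentially bounded function, as a bounded operator on `L²(μ)`. -/
def mulCLM (hm : MemLp m ∞ μ) : Lp ℂ 2 μ →L[ℂ] Lp ℂ 2 μ :=
  (ContinuousLinearMap.mul ℂ ℂ).holderL μ ∞ 2 2 (hm.toLp m)

theorem coeFn_mulCLM (hm : MemLp m ∞ μ) (f : Lp ℂ 2 μ) :
    mulCLM hm f =ᵐ[μ] fun t => m t * f t := by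
  filter_upwards [(ContinuousLinearMap.mul ℂ ℂ).coeFn_holder (r := 2) (hm.toLp m) f,
    hm.coeFn_toLp] with t ht hmt
  rw [← hmt]
  exact ht

theorem enorm_sq_eq_lintegral (f : Lp ℂ 2 μ) : ‖f‖ₑ ^ 2 = ∫⁻ t, ‖f t‖ₑ ^ 2 ∂μ := by
  have h := eLpNorm_nnreal_pow_eq_lintegral (f := f) (μ := μ) (p := 2) two_ne_zero
  simpa only [Lp.enorm_def, NNReal.coe_ofNat, ENNReal.coe_ofNat, ENNReal.rpow_ofNat] using h

/-- The measure `|f|² dμ`. -/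
def density (f : Lp ℂ 2 μ) : Measure X := μ.withDensity fun t => ‖f t‖ₑ ^ 2

instance isFiniteMeasure_density (f : Lp ℂ 2 μ) : IsFiniteMeasure (density f) :=
  isFiniteMeasure_withDensity <| by
    rw [← enorm_sq_eq_lintegral]
    exact ENNReal.pow_ne_top enorm_ne_top

theorem memLp_density_iff (hm : Measurable m) (f : Lp ℂ 2 μ) :
    MemLp m 2 (density f) ↔ MemLp (fun t => m t * f t) 2 μ := by
  have hf := Lp.aestronglyMeasurable f
  have hmf : AEStronglyMeasurable (fun t => m t * f t) μ := hm.aestronglyMeasurable.mul hf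
  have hlint : ∫⁻ t, ‖m t‖ₑ ^ (2 : ℝ) ∂(density f) = ∫⁻ t, ‖m t * f t‖ₑ ^ (2 : ℝ) ∂μ := by
    rw [density, lintegral_withDensity_eq_lintegral_mul₀ (hf.enorm.pow_const 2)
      (hm.enorm.pow_const _).aemeasurable]
    refine lintegral_congr fun t => ?_
    simp [mul_pow, mul_comm]
  rw [MemLp, MemLp, eLpNorm_lt_top_iff_lintegral_rpow_enorm_lt_top (by simp) (by simp),
    eLpNorm_lt_top_iff_lintegral_rpow_enorm_lt_top (by simp) (by simp)]
  simp only [ENNReal.toReal_ofNat, hlint, hm.aestronglyMeasurable, hmf,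
    true_and]

theorem integral_density (m : X → ℂ) (f : Lp ℂ 2 μ) :
    ∫ t, m t ∂(density f) = ∫ t, m t * (‖f t‖ ^ 2 : ℝ) ∂μ := by
  rw [density, integral_withDensity_eq_integral_toReal_smul₀
    ((Lp.aestronglyMeasurable f).enorm.pow_const 2) (by filter_upwards with t; simp)]
  refine integral_congr_ae ?_
  filter_upwards with t
  simp [mul_comm]

section SpectralMeasure

variable {z : X → ℂ} {s t : Set ℂ}

open Classical in
/-- Multiplication by the indicator function of `z ⁻¹' s`: the spectral projection, for the set `s`,
of the operator of multiplication by `z`. It is `0` if `s` is not measurable. -/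
def mulProj (μ : Measure X) (hz : Measurable z) (s : Set ℂ) : Lp ℂ 2 μ →L[ℂ] Lp ℂ 2 μ :=
  if hs : MeasurableSet s then mulCLM ((memLp_top_const (1 : ℂ)).indicator (hz hs)) else 0

theorem coeFn_mulProj (hz : Measurable z) (hs : MeasurableSet s) (f : Lp ℂ 2 μ) :
    mulProj μ hz s f =ᵐ[μ] (z ⁻¹' s).indicator f := by
  rw [mulProj, dif_pos hs]
  filter_upwards [coeFn_mulCLM ((memLp_top_const (1 : ℂ)).indicator (hz hs)) f] with a ha
  by_cases hzs : a ∈ z ⁻¹' s <;> simp [ha, hzs]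

theorem mulProj_mulProj (hz : Measurable z) (hs : MeasurableSet s) (ht : MeasurableSet t)
    (f : Lp ℂ 2 μ) : mulProj μ hz s (mulProj μ hz t f) = mulProj μ hz (s ∩ t) f := by
  refine Lp.ext ((coeFn_mulProj hz hs _).trans ?_)
  filter_upwards [coeFn_mulProj hz ht f, coeFn_mulProj hz (hs.inter ht) f] with a hta hsta
  rw [hsta, preimage_inter, ← indicator_indicator]
  by_cases ha : a ∈ z ⁻¹' s <;> simp [ha, hta]

theorem mulProj_univ (hz : Measurable z) (f : Lp ℂ 2 μ) : mulProj μ hz univ f = f :=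
  Lp.ext (by simpa using coeFn_mulProj hz .univ f)

theorem mulProj_union (hz : Measurable z) (hs : MeasurableSet s) (ht : MeasurableSet t)
    (hd : Disjoint s t) (f : Lp ℂ 2 μ) :
    mulProj μ hz (s ∪ t) f = mulProj μ hz s f + mulProj μ hz t f := by
  refine Lp.ext ((coeFn_mulProj hz (hs.union ht) f).trans ?_)
  rw [preimage_union, indicator_union_of_disjoint (hd.preimage z)]
  exact ((coeFn_mulProj hz hs f).symm.add (coeFn_mulProj hz ht f).symm).trans
    (Lp.coeFn_add _ _).symm

theorem norm_mulProj_sq (hz : Measurable z) (hs : MeasurableSet s) (f : Lp ℂ 2 μ) :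
    ‖mulProj μ hz s f‖ ^ 2 = ((density f).map z).real s := by
  have h : ‖mulProj μ hz s f‖ₑ ^ 2 = (density f).map z s := by
    rw [Measure.map_apply hz hs, density, withDensity_apply _ (hz hs), enorm_sq_eq_lintegral,
      ← lintegral_indicator (hz hs)]
    refine lintegral_congr_ae ?_
    filter_upwards [coeFn_mulProj hz hs f] with a ha
    rw [ha, enorm_indicator_eq_indicator_enorm]
    by_cases hzs : a ∈ z ⁻¹' s <;> simp [hzs]
  rw [measureReal_def, ← h, ENNReal.toReal_pow, toReal_enorm]

theorem isStarProjection_mulProj (hz : Measurable z) (hs : MeasurableSet s) :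
    IsStarProjection (mulProj μ hz s) where
  isIdempotentElem := by
    ext1 f
    rw [mul_apply_eq_comp, mulProj_mulProj hz hs hs, inter_self]
  isSelfAdjoint := by
    refine ContinuousLinearMap.isSelfAdjoint_iff_isSymmetric.2 fun f g => ?_
    rw [ContinuousLinearMap.coe_coe, L2.inner_def, L2.inner_def]
    refine integral_congr_ae ?_
    filter_upwards [coeFn_mulProj hz hs f, coeFn_mulProj hz hs g] with a hf hg
    rw [hf, hg]
    by_cases ha : a ∈ z ⁻¹' s <;> simp [ha]

/-- The resolution of the identity of the operator of multiplication by `z`. -/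
def mulResolution (μ : Measure X) (hz : Measurable z) : ResolutionOfIdentity (Lp ℂ 2 μ) where
  proj := mulProj μ hz
  isStarProjection _ hs := isStarProjection_mulProj hz hs
  proj_of_not_measurable _ hs := dif_neg hs
  proj_univ := ContinuousLinearMap.ext (mulProj_univ hz)
  proj_inter _ _ hs ht := ContinuousLinearMap.ext fun f => (mulProj_mulProj hz hs ht f).symm
  hasSum_iUnion _ hs hd f := hasSum_of_norm_sq_eq_measureReal (m := fun s => mulProj μ hz s f)
    (fun _ _ hs ht hd => mulProj_union hz hs ht hd f) (fun _ hs => norm_mulProj_sq hz hs f) hs hd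

theorem scalarMeasure_mulResolution (hz : Measurable z) (f : Lp ℂ 2 μ) :
    (mulResolution μ hz).scalarMeasure f = (density f).map z := by
  ext s hs
  rw [ResolutionOfIdentity.scalarMeasure_apply _ f hs, ← ofReal_measureReal,
    ← norm_mulProj_sq hz hs]
  rfl

theorem isIntegral_mulResolution (hz : Measurable z) {φ : ℂ → ℂ} (hφ : Measurable φ) :
    (mulResolution μ hz).IsIntegral φ (mulOp μ (φ ∘ z)) := by
  refine ⟨fun f => ?_, fun f => ?_⟩
  · rw [scalarMeasure_mulResolution, memLp_map_measure_iff hφ.aestronglyMeasurable hz.aemeasurable,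
      memLp_density_iff (hφ.comp hz), mem_mulOp_domain]
  · rw [scalarMeasure_mulResolution, integral_map hz.aemeasurable hφ.aestronglyMeasurable,
      integral_density, L2.inner_def]
    refine integral_congr_ae ?_
    filter_upwards [coeFn_mulOp f] with a ha
    rw [ha, RCLike.inner_apply, Function.comp_apply, mul_assoc, Complex.mul_conj,
      Complex.normSq_eq_norm_sq]

theorem isFunctionOf_mulOp (hz : Measurable z) {φ : ℂ → ℂ} (hφ : Measurable φ) :
    IsFunctionOf (mulOp μ z) φ (mulOp μ (φ ∘ z)) :=
  ⟨mulResolution μ hz, isIntegral_mulResolution hz measurable_id, isIntegral_mulResolution hz hφ⟩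

end SpectralMeasure

theorem isInvertible_mulOp_of_le (hm : Measurable m) {ε : ℝ} (hε : 0 < ε)
    (h : ∀ᵐ t ∂μ, ε ≤ ‖m t‖) : IsInvertible (mulOp μ m) := by
  have hinv : MemLp (fun t => (m t)⁻¹) ∞ μ := by
    refine memLp_top_of_bound hm.inv.aestronglyMeasurable ε⁻¹ ?_
    filter_upwards [h] with t ht
    rw [norm_inv]
    exact inv_anti₀ hε ht
  have hne : ∀ᵐ t ∂μ, m t ≠ 0 := h.mono fun t ht => norm_pos_iff.1 (hε.trans_le ht)
  have hright (u : Lp ℂ 2 μ) : u =ᵐ[μ] fun t => m t * mulCLM hinv u t := by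
    filter_upwards [hne, coeFn_mulCLM hinv u] with t ht hu
    rw [hu, mul_inv_cancel_left₀ ht]
  have hleft (v : (mulOp μ m).domain) : mulCLM hinv (mulOp μ m v) = v := by
    refine Lp.ext ?_
    filter_upwards [hne, coeFn_mulCLM hinv (mulOp μ m v), coeFn_mulOp v] with t ht hinvt hv
    rw [hinvt, hv, inv_mul_cancel_left₀ ht]
  refine ⟨mulCLM hinv, Subset.antisymm ?_ fun v hv => ⟨_, hleft ⟨v, hv⟩⟩,
    fun u _ => mulOp_eq_of_ae (hright u), hleft⟩
  exact range_subset_iff.2 fun u => mem_mulOp_domain_of_ae (hright u)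

theorem exists_norm_mulOp_le [SigmaFinite μ] (hm : Measurable m) {ε : ℝ}
    (h : ¬ ∀ᵐ t ∂μ, ε ≤ ‖m t‖) :
    ∃ f : (mulOp μ m).domain, f ≠ 0 ∧ ‖mulOp μ m f‖ ≤ ε * ‖f‖ := by
  have hpos : 0 < μ {t | ‖m t‖ < ε} := by
    rw [ae_iff] at h
    simpa only [not_le, pos_iff_ne_zero] using h
  obtain ⟨s, hs, hsub, hs0, hfin⟩ :=
    Measure.exists_subset_measure_lt_top (measurableSet_lt hm.norm measurable_const) hpos
  let f : Lp ℂ 2 μ := indicatorConstLp 2 hs hfin.ne 1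
  have hbound : ∀ᵐ t ∂μ, ‖m t * f t‖ ≤ ε * ‖f t‖ := by
    filter_upwards [indicatorConstLp_coeFn (p := 2) (hs := hs) (hμs := hfin.ne) (c := (1 : ℂ))]
      with t ht
    rw [norm_mul, ht]
    by_cases hts : t ∈ s
    · exact mul_le_mul_of_nonneg_right (hsub hts).le (norm_nonneg _)
    · simp [hts]
  have hf : f ∈ (mulOp μ m).domain :=
    (Lp.memLp f).of_le_mul (hm.aestronglyMeasurable.mul (Lp.aestronglyMeasurable f)) hbound
  refine ⟨⟨f, hf⟩, fun h0 => ?_, Lp.norm_le_mul_norm_of_ae_le_mul ?_⟩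
  · have hnorm : ‖f‖ = 0 := norm_eq_zero.2 (congrArg Subtype.val h0)
    rw [norm_indicatorConstLp two_ne_zero ENNReal.ofNat_ne_top, norm_one, one_mul] at hnorm
    exact (Real.rpow_pos_of_pos (ENNReal.toReal_pos hs0.ne' hfin.ne) _).ne' hnorm
  · filter_upwards [hbound, coeFn_mulOp ⟨f, hf⟩] with t ht hmul
    rwa [hmul]

theorem exists_le_of_isInvertible_mulOp [SigmaFinite μ] (hm : Measurable m)
    (h : IsInvertible (mulOp μ m)) : ∃ ε : ℝ, 0 < ε ∧ ∀ᵐ t ∂μ, ε ≤ ‖m t‖ := by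
  obtain ⟨B, -, -, hleft⟩ := h
  refine ⟨(‖B‖ + 1)⁻¹, by positivity, ?_⟩
  by_contra hcon
  obtain ⟨f, hf0, hf⟩ := exists_norm_mulOp_le hm hcon
  have hlt : ‖f‖ < ‖f‖ := calc
    ‖f‖ = ‖B (mulOp μ m f)‖ := by rw [hleft, Submodule.coe_norm]
    _ ≤ ‖B‖ * ‖mulOp μ m f‖ := B.le_opNorm _
    _ ≤ ‖B‖ * ((‖B‖ + 1)⁻¹ * ‖f‖) := by gcongr
    _ = ‖B‖ / (‖B‖ + 1) * ‖f‖ := by ring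
    _ < 1 * ‖f‖ := mul_lt_mul_of_pos_right
        ((div_lt_one (by positivity)).2 (lt_add_one _)) (norm_pos_iff.2 hf0)
    _ = ‖f‖ := one_mul _
  exact hlt.false

theorem isInvertible_mulOp_iff [SigmaFinite μ] (hm : Measurable m) :
    IsInvertible (mulOp μ m) ↔ ∃ ε : ℝ, 0 < ε ∧ ∀ᵐ t ∂μ, ε ≤ ‖m t‖ :=
  ⟨exists_le_of_isInvertible_mulOp hm, fun ⟨_, hε, h⟩ => isInvertible_mulOp_of_le hm hε h⟩

end Multiplication

section AbsolutelyContinuous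

theorem isAC_of_contDiff {g : ℝ → ℂ} (hg : ContDiff ℝ 1 g) : IsAC g :=
  fun _ _ => hg.contDiffOn.absolutelyContinuousOnInterval

theorem isAC_const (w : ℂ) : IsAC fun _ => w :=
  isAC_of_contDiff contDiff_const

theorem IsAC.mul {f g : ℝ → ℂ} (hf : IsAC f) (hg : IsAC g) : IsAC fun t => f t * g t :=
  fun a b => (hf a b).smul (hg a b)

theorem absolutelyContinuousOnInterval_primitive {f : ℝ → ℝ}
    (hf : ∀ a b, IntervalIntegrable f volume a b) (x a b : ℝ) :
    AbsolutelyContinuousOnInterval (fun t => ∫ s in x..t, f s) a b := by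
  have hle : min x (min a b) ≤ max x (max a b) := (min_le_left _ _).trans (le_max_left _ _)
  have hsub : uIcc a b ⊆ uIcc (min x (min a b)) (max x (max a b)) := by
    rw [uIcc_of_le hle]
    exact Icc_subset_Icc (min_le_right _ _) (le_max_right _ _)
  have hx : x ∈ uIcc (min x (min a b)) (max x (max a b)) := by
    rw [uIcc_of_le hle]
    exact ⟨min_le_left _ _, le_max_left _ _⟩
  exact ((hf _ _).absolutelyContinuousOnInterval_intervalIntegral hx).mono hsub

theorem isAC_primitive {f : ℝ → ℂ} (hf : ∀ a b, IntervalIntegrable f volume a b) (x : ℝ) :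
    IsAC fun t => ∫ s in x..t, f s := by
  have hsplit : (fun t => ∫ s in x..t, f s) =
      (fun t => (∫ s in x..t, (f s).re) • (1 : ℂ)) + fun t => (∫ s in x..t, (f s).im) • I := by
    funext t
    have hre := reCLM.intervalIntegral_comp_comm (hf x t)
    have him := imCLM.intervalIntegral_comp_comm (hf x t)
    simp only [reCLM_apply, imCLM_apply] at hre him
    rw [Pi.add_apply, hre, him, real_smul, real_smul, mul_one, re_add_im]
  rw [hsplit]
  intro a b
  exact ((absolutelyContinuousOnInterval_primitive
      (fun a b => ⟨(hf a b).1.re, (hf a b).2.re⟩) x a b).smul (isAC_const 1 a b)).add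
    ((absolutelyContinuousOnInterval_primitive
      (fun a b => ⟨(hf a b).1.im, (hf a b).2.im⟩) x a b).smul (isAC_const I a b))

theorem isAC_exp_mul (k : ℂ) : IsAC fun t : ℝ => exp (k * t) :=
  isAC_of_contDiff (contDiff_const.mul ofRealCLM.contDiff).cexp

theorem hasDerivAt_exp_mul_ofReal (k : ℂ) (t : ℝ) :
    HasDerivAt (fun t : ℝ => exp (k * t)) (exp (k * t) * k) t := by
  simpa using ((ofRealCLM.hasDerivAt (x := t)).const_mul k).cexp

theorem exp_mul_exp_neg_mul_cancel (k w a : ℂ) : exp (k * w) * (exp (-k * w) * a) = a := by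
  rw [← mul_assoc, ← exp_add, neg_mul, add_neg_cancel, exp_zero, one_mul]

theorem IsAC.eq_mul_exp_of_deriv {g : ℝ → ℂ} (hg : IsAC g) {k : ℂ}
    (h : ∀ᵐ t, deriv g t = k * g t) : ∃ C : ℂ, ∀ t : ℝ, g t = C * exp (k * t) := by
  have hderiv : ∀ᵐ t : ℝ, HasDerivAt (fun t : ℝ => exp (-k * t) * g t) 0 t := by
    filter_upwards [h, hg.ae_differentiableAt] with t ht hd
    refine ((hasDerivAt_exp_mul_ofReal (-k) t).mul hd.hasDerivAt).congr_deriv ?_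
    rw [ht]
    ring
  refine ⟨g 0, fun t => ?_⟩
  obtain ⟨C, hC⟩ :=
    ((isAC_exp_mul (-k)).mul hg 0 t).const_of_ae_hasDerivAt_zero (hderiv.mono fun x hx _ => hx)
  have h0 : g 0 = C := by simpa using hC 0 left_mem_uIcc
  rw [h0, ← hC t right_mem_uIcc, mul_comm, exp_mul_exp_neg_mul_cancel]

end AbsolutelyContinuous

section Weight

variable (c : ℝ)

theorem eLpNorm_weight (f : ℝ → ℂ) :
    eLpNorm (fun t : ℝ => exp (-c * t) * f t) 2 volume = eLpNorm f 2 (weight c) := by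
  have hexp (t : ℝ) : ‖exp (-c * t)‖ₑ ^ 2 = ENNReal.ofReal (Real.exp (-2 * c * t)) := by
    rw [← ofReal_norm, norm_exp, ← ENNReal.ofReal_pow (Real.exp_pos _).le, ← Real.exp_nat_mul]
    congr 2
    simp only [neg_mul, neg_re, re_ofReal_mul, ofReal_re, Nat.cast_ofNat]
    ring
  rw [eLpNorm_eq_lintegral_rpow_enorm_toReal (by simp) (by simp),
    eLpNorm_eq_lintegral_rpow_enorm_toReal (by simp) (by simp), weight,
    lintegral_withDensity_eq_lintegral_mul_non_measurable _ (by fun_prop)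
      (Eventually.of_forall fun _ => ENNReal.ofReal_lt_top)]
  simp only [ENNReal.toReal_ofNat, ENNReal.rpow_ofNat, Pi.mul_apply, enorm_mul, mul_pow, hexp]

theorem memLp_weight_iff (f : ℝ → ℂ) :
    MemLp (fun t : ℝ => exp (-c * t) * f t) 2 volume ↔ MemLp f 2 (weight c) := by
  have hexp (k : ℂ) : AEStronglyMeasurable (fun t : ℝ => exp (k * t)) volume :=
    (isAC_exp_mul k).continuous.aestronglyMeasurable
  rw [MemLp, MemLp, eLpNorm_weight]
  refine and_congr_left fun _ => ⟨fun h => ?_, fun h => ?_⟩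
  · have hmul := ((hexp c).mul h).mono_ac (weight_ac_volume c)
    exact hmul.congr (Eventually.of_forall fun t => exp_mul_exp_neg_mul_cancel _ _ _)
  · exact (hexp (-c)).mul (h.mono_ac (volume_ac_weight c))

/-- Multiplication by `e^{-ct}`, as an isometry of the weighted into the unweighted space. -/
def weightIsometry : Hc c →ₗᵢ[ℂ] Lp ℂ 2 (volume : Measure ℝ) where
  toFun f := ((memLp_weight_iff c f).2 (Lp.memLp f)).toLp
  map_add' f g := by
    rw [← MemLp.toLp_add]
    exact MemLp.toLp_congr _ _ ((volume_ac_weight c).ae_le (mul_coeFn_add _ f g))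
  map_smul' a f := by
    rw [RingHom.id_apply, ← MemLp.toLp_const_smul]
    exact MemLp.toLp_congr _ _ ((volume_ac_weight c).ae_le (mul_coeFn_smul _ a f))
  norm_map' f := by
    refine (Lp.norm_toLp _ ((memLp_weight_iff c f).2 (Lp.memLp f))).trans ?_
    rw [eLpNorm_weight, Lp.norm_def]

theorem coeFn_weightIsometry (f : Hc c) :
    weightIsometry c f =ᵐ[volume] fun t : ℝ => exp (-c * t) * f t :=
  MemLp.coeFn_toLp ((memLp_weight_iff c f).2 (Lp.memLp f))

theorem surjective_weightIsometry : Function.Surjective (weightIsometry c) := by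
  intro g
  have hcancel (t : ℝ) : exp (-c * t) * (exp (c * t) * g t) = g t := by
    simpa only [neg_neg] using exp_mul_exp_neg_mul_cancel (-c) t (g t)
  have hmem : MemLp (fun t : ℝ => exp (c * t) * g t) 2 (weight c) := by
    rw [← memLp_weight_iff]
    simpa only [hcancel] using Lp.memLp g
  refine ⟨hmem.toLp, Lp.ext ?_⟩
  filter_upwards [coeFn_weightIsometry c hmem.toLp,
    (volume_ac_weight c).ae_le hmem.coeFn_toLp] with t hiso hrep
  rw [hiso, hrep, hcancel]

end Weight

section Fourier

open FourierTransform SchwartzMap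

theorem tendsto_setIntegral_of_tendsto_L2 {X ι : Type*} [MeasurableSpace X] {μ : Measure X}
    {l : Filter ι} {F : ι → Lp ℂ 2 μ} {f : Lp ℂ 2 μ} (h : Tendsto F l (𝓝 f)) {s : Set X}
    (hs : MeasurableSet s) (hμs : μ s ≠ ∞) :
    Tendsto (fun n => ∫ t in s, F n t ∂μ) l (𝓝 (∫ t in s, f t ∂μ)) := by
  simpa only [L2.inner_indicatorConstLp_one] using
    (tendsto_const_nhds (x := indicatorConstLp 2 hs hμs (1 : ℂ))).inner (𝕜 := ℂ) h

theorem tendsto_sub_apply_of_tendsto_derivCLM {ι : Type*} {l : Filter ι} {p : ι → 𝓢(ℝ, ℂ)}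
    {v : Lp ℂ 2 (volume : Measure ℝ)}
    (hv : Tendsto (fun n => (derivCLM ℂ ℂ (p n)).toLp 2) l (𝓝 v)) (a b : ℝ) :
    Tendsto (fun n => p n b - p n a) l (𝓝 (∫ t in a..b, v t)) := by
  have hFTC (n) : p n b - p n a = ∫ t in a..b, deriv (p n) t :=
    (intervalIntegral.integral_deriv_eq_sub (fun t _ => (p n).differentiableAt)
      ((derivCLM ℂ ℂ (p n)).continuous.intervalIntegrable _ _)).symm
  have hset (a b : ℝ) : Tendsto (fun n => ∫ t in Ioc a b, deriv (p n) t) l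
      (𝓝 (∫ t in Ioc a b, v t)) :=
    (tendsto_setIntegral_of_tendsto_L2 hv measurableSet_Ioc measure_Ioc_lt_top.ne).congr fun n =>
      integral_congr_ae (ae_restrict_of_ae ((derivCLM ℂ ℂ (p n)).coeFn_toLp 2 volume))
  simpa only [hFTC, intervalIntegral] using (hset a b).sub (hset b a)

theorem exists_seq_tendsto_ae_of_tendsto_toLp {p : ℕ → 𝓢(ℝ, ℂ)}
    {u : Lp ℂ 2 (volume : Measure ℝ)} (hu : Tendsto (fun n => (p n).toLp 2) atTop (𝓝 u)) :
    ∃ ns : ℕ → ℕ, StrictMono ns ∧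
      ∀ᵐ t : ℝ, Tendsto (fun n => p (ns n) t) atTop (𝓝 (u t)) := by
  obtain ⟨ns, hns, hae⟩ := (tendstoInMeasure_of_tendsto_Lp hu).exists_seq_tendsto_ae
  have hrep : ∀ᵐ t : ℝ, ∀ n, (p n).toLp 2 volume t = p n t :=
    ae_all_iff.2 fun n => (p n).coeFn_toLp 2 volume
  refine ⟨ns, hns, ?_⟩
  filter_upwards [hae, hrep] with t ht hpt
  simpa only [hpt] using ht

theorem exists_isAC_of_tendsto {p : ℕ → 𝓢(ℝ, ℂ)} {u v : Lp ℂ 2 (volume : Measure ℝ)}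
    (hu : Tendsto (fun n => (p n).toLp 2) atTop (𝓝 u))
    (hv : Tendsto (fun n => (derivCLM ℂ ℂ (p n)).toLp 2) atTop (𝓝 v)) :
    ∃ g : ℝ → ℂ, IsAC g ∧ u =ᵐ[volume] g ∧ v =ᵐ[volume] deriv g := by
  obtain ⟨ns, hns, hpt⟩ := exists_seq_tendsto_ae_of_tendsto_toLp hu
  obtain ⟨a, ha⟩ := hpt.exists
  have hloc : LocallyIntegrable v := (Lp.memLp v).locallyIntegrable one_le_two
  have hprim : IsAC fun t => ∫ s in a..t, v s :=
    isAC_primitive (fun _ _ => (hloc.integrableOn_isCompact isCompact_uIcc).intervalIntegrable) a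
  refine ⟨fun t => u a + ∫ s in a..t, v s, fun x y => (isAC_const (u a) x y).add (hprim x y),
    ?_, ?_⟩
  · filter_upwards [hpt] with t ht
    have hdiff := (tendsto_sub_apply_of_tendsto_derivCLM hv a t).comp hns.tendsto_atTop
    rw [← tendsto_nhds_unique (ht.sub ha) hdiff, add_sub_cancel]
  · filter_upwards [LocallyIntegrable.ae_hasDerivAt_integral hloc] with t ht
    exact ((ht a).const_add (u a)).deriv.symm

theorem one_le_norm_two_pi_I_mul_sub_one (ξ : ℝ) : 1 ≤ ‖2 * Real.pi * I * ξ - 1‖ := by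
  simpa using abs_re_le_norm (2 * Real.pi * I * ξ - 1)

theorem two_pi_I_mul_sub_one_ne_zero (ξ : ℝ) : 2 * Real.pi * I * ξ - 1 ≠ 0 :=
  norm_pos_iff.1 (one_pos.trans_le (one_le_norm_two_pi_I_mul_sub_one ξ))

theorem hasTemperateGrowth_inv_two_pi_I_mul_sub_one :
    (fun ξ : ℝ => (2 * Real.pi * I * ξ - 1)⁻¹).HasTemperateGrowth := by
  have hinv : (fun ξ : ℝ => (1 + ‖2 * Real.pi * ξ‖ ^ 2) ^ (-1 : ℝ)).HasTemperateGrowth :=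
    (Function.hasTemperateGrowth_one_add_norm_sq_rpow ℝ (-1)).comp
      ((Function.HasTemperateGrowth.const _).mul Function.HasTemperateGrowth.id')
  have hconj : (fun ξ : ℝ => -(1 + 2 * Real.pi * I * (ξ : ℂ))).HasTemperateGrowth :=
    ((Function.HasTemperateGrowth.const _).add
      ((Function.HasTemperateGrowth.const _).mul Function.Complex.hasTemperateGrowth_ofReal)).neg
  refine (congrArg (fun F : ℝ → ℂ => F.HasTemperateGrowth) (funext fun ξ => ?_)).mpr
    (hconj.mul (Function.Complex.hasTemperateGrowth_ofReal.comp hinv))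
  have hne : (1 + (2 * Real.pi * ξ) ^ 2 : ℂ) ≠ 0 := by
    exact_mod_cast (by positivity : (0 : ℝ) < 1 + (2 * Real.pi * ξ) ^ 2).ne'
  refine inv_eq_of_mul_eq_one_right ?_
  simp only [Pi.mul_apply, Function.comp_apply, Real.rpow_neg_one, Real.norm_eq_abs, sq_abs]
  push_cast
  rw [← mul_assoc, mul_inv_eq_one₀ hne]
  linear_combination (-4 * (Real.pi : ℂ) ^ 2 * ξ ^ 2) * I_sq

/-- The solution `q` of `(2πiξ - 1) q = s`, the Fourier side of the resolvent of `d/dt` at `1`. -/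
def fourierResolvent (s : 𝓢(ℝ, ℂ)) : 𝓢(ℝ, ℂ) :=
  smulLeftCLM ℂ (fun ξ : ℝ => (2 * Real.pi * I * ξ - 1)⁻¹) s

theorem two_pi_I_mul_sub_one_mul_fourierResolvent (s : 𝓢(ℝ, ℂ)) (ξ : ℝ) :
    (2 * Real.pi * I * ξ - 1) * fourierResolvent s ξ = s ξ := by
  rw [fourierResolvent, smulLeftCLM_apply_apply hasTemperateGrowth_inv_two_pi_I_mul_sub_one,
    smul_eq_mul, mul_inv_cancel_left₀ (two_pi_I_mul_sub_one_ne_zero ξ)]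

theorem derivCLM_fourierInv_fourierResolvent (s : 𝓢(ℝ, ℂ)) :
    derivCLM ℂ ℂ (𝓕⁻ (fourierResolvent s)) = 𝓕⁻ (s + fourierResolvent s) := by
  have hmul : (2 * Real.pi * I) •
      smulLeftCLM ℂ (fun x : ℝ => inner ℝ x (1 : ℝ)) (fourierResolvent s) =
        s + fourierResolvent s := by
    ext ξ
    rw [_root_.smul_apply, _root_.add_apply,
      smulLeftCLM_apply_apply (Function.hasTemperateGrowth_inner_left (1 : ℝ)),
      ← two_pi_I_mul_sub_one_mul_fourierResolvent s]
    simp only [RCLike.inner_apply, conj_trivial, one_mul, smul_eq_mul, real_smul]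
    ring
  rw [← hmul, ← lineDerivOp_fourierInv_eq]
  ext t
  rw [derivCLM_apply, lineDerivOp_apply_eq_fderiv, fderiv_apply_one_eq_deriv]

theorem tendsto_toLp_fourierResolvent {ι : Type*} {l : Filter ι} {s : ι → 𝓢(ℝ, ℂ)}
    {f w : Lp ℂ 2 (volume : Measure ℝ)}
    (hw : w =ᵐ[volume] fun ξ => (2 * Real.pi * I * ξ - 1) * f ξ)
    (hs : Tendsto (fun n => (s n).toLp 2) l (𝓝 w)) :
    Tendsto (fun n => (fourierResolvent (s n)).toLp 2) l (𝓝 f) := by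
  rw [tendsto_iff_norm_sub_tendsto_zero] at hs ⊢
  refine squeeze_zero (fun _ => norm_nonneg _) (fun n => Lp.norm_le_norm_of_ae_le ?_) hs
  filter_upwards [Lp.coeFn_sub ((fourierResolvent (s n)).toLp 2) f,
    Lp.coeFn_sub ((s n).toLp 2) w, (fourierResolvent (s n)).coeFn_toLp 2 volume,
    (s n).coeFn_toLp 2 volume, hw] with ξ hqf hsw hqξ hsξ hwξ
  rw [hqf, hsw, Pi.sub_apply, Pi.sub_apply, hqξ, hsξ, hwξ,
    ← two_pi_I_mul_sub_one_mul_fourierResolvent (s n), ← mul_sub, norm_mul]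
  exact le_mul_of_one_le_left (norm_nonneg _) (one_le_norm_two_pi_I_mul_sub_one ξ)

theorem exists_seq_toLp_tendsto (w : Lp ℂ 2 (volume : Measure ℝ)) :
    ∃ s : ℕ → 𝓢(ℝ, ℂ), Tendsto (fun n => (s n).toLp 2) atTop (𝓝 w) := by
  obtain ⟨σ, hσ, hlim⟩ := mem_closure_iff_seq_limit.1
    (denseRange_toLpCLM (F := ℂ) (p := 2) (μ := (volume : Measure ℝ)) ENNReal.ofNat_ne_top w)
  choose s hs using hσ
  exact ⟨s, hlim.congr fun n => (hs n).symm⟩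

theorem tendsto_toLp_fourierInv {ι : Type*} {l : Filter ι} {q : ι → 𝓢(ℝ, ℂ)}
    {f : Lp ℂ 2 (volume : Measure ℝ)}
    (hq : Tendsto (fun n => (q n).toLp 2) l (𝓝 (Lp.fourierTransformₗᵢ ℝ ℂ f))) :
    Tendsto (fun n => (𝓕⁻ (q n)).toLp 2) l (𝓝 f) := by
  have h := ((Lp.fourierTransformₗᵢ ℝ ℂ).symm.continuous.tendsto _).comp hq
  rw [LinearIsometryEquiv.symm_apply_apply] at h
  exact h.congr fun n => toLp_fourierInv_eq (q n)

theorem exists_isAC_of_fourier {u v : Lp ℂ 2 (volume : Measure ℝ)}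
    (h : Lp.fourierTransformₗᵢ ℝ ℂ v =ᵐ[volume]
      fun ξ => 2 * Real.pi * I * ξ * Lp.fourierTransformₗᵢ ℝ ℂ u ξ) :
    ∃ g : ℝ → ℂ, IsAC g ∧ u =ᵐ[volume] g ∧ v =ᵐ[volume] deriv g := by
  have hsub : (Lp.fourierTransformₗᵢ ℝ ℂ v - Lp.fourierTransformₗᵢ ℝ ℂ u :
      Lp ℂ 2 (volume : Measure ℝ)) =ᵐ[volume]
        fun ξ => (2 * Real.pi * I * ξ - 1) * Lp.fourierTransformₗᵢ ℝ ℂ u ξ := by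
    filter_upwards [Lp.coeFn_sub (Lp.fourierTransformₗᵢ ℝ ℂ v) (Lp.fourierTransformₗᵢ ℝ ℂ u),
      h] with ξ hξ hv
    rw [hξ, Pi.sub_apply, hv, sub_mul, one_mul]
  obtain ⟨s, hs⟩ :=
    exists_seq_toLp_tendsto (Lp.fourierTransformₗᵢ ℝ ℂ v - Lp.fourierTransformₗᵢ ℝ ℂ u)
  have hq := tendsto_toLp_fourierResolvent hsub hs
  have hsq : Tendsto (fun n => (s n + fourierResolvent (s n)).toLp 2) atTop
      (𝓝 (Lp.fourierTransformₗᵢ ℝ ℂ v)) := by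
    rw [← sub_add_cancel (Lp.fourierTransformₗᵢ ℝ ℂ v) (Lp.fourierTransformₗᵢ ℝ ℂ u)]
    exact hs.add hq
  refine exists_isAC_of_tendsto (tendsto_toLp_fourierInv hq) ?_
  simpa only [derivCLM_fourierInv_fourierResolvent] using tendsto_toLp_fourierInv hsq

end Fourier

section Shift

theorem linearPMap_eq_of_le_of_surjective_of_injective {R E : Type*} [Ring R] [AddCommGroup E]
    [Module R E] {A B : E →ₗ.[R] E} (hBA : B ≤ A) (k : R)
    (hsurj : ∀ w, ∃ x : B.domain, B x - k • (x : E) = w)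
    (hinj : ∀ x : A.domain, A x = k • (x : E) → (x : E) = 0) : B = A := by
  refine LinearPMap.eq_of_le_of_domain_eq hBA (le_antisymm hBA.1 fun x hx => ?_)
  obtain ⟨y, hy⟩ := hsurj (A ⟨x, hx⟩ - k • x)
  have hBy : A ⟨y, hBA.1 y.2⟩ = B y := (hBA.2 rfl).symm
  have hxy : x - y = 0 := by
    refine hinj (⟨x, hx⟩ - ⟨y, hBA.1 y.2⟩) ?_
    rw [LinearPMap.map_sub, hBy, ← sub_eq_zero, Submodule.coe_sub, smul_sub, sub_sub_sub_comm,
      hy, sub_self]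
  exact sub_eq_zero.1 hxy ▸ y.2

theorem exists_mulOp_sub_smul_eq {X : Type*} [MeasurableSpace X] {μ : Measure X} {m : X → ℂ} {k : ℂ}
    (hne : ∀ᵐ t ∂μ, m t ≠ k) (hinv : MemLp (fun t => (m t - k)⁻¹) ∞ μ) (w : Lp ℂ 2 μ) :
    ∃ x : (mulOp μ m).domain, mulOp μ m x - k • (x : Lp ℂ 2 μ) = w := by
  obtain ⟨x, hx⟩ : ∃ x : Lp ℂ 2 μ, x =ᵐ[μ] fun t => (m t - k)⁻¹ * w t := ⟨_, coeFn_mulCLM hinv w⟩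
  have hmul : (w + k • x : Lp ℂ 2 μ) =ᵐ[μ] fun t => m t * x t := by
    filter_upwards [Lp.coeFn_add w (k • x), Lp.coeFn_smul k x, hx, hne] with t hadd hsmul hxt ht
    have hcancel : (m t - k) * x t = w t := by
      rw [hxt, mul_inv_cancel_left₀ (sub_ne_zero.2 ht)]
    rw [hadd, Pi.add_apply, hsmul, Pi.smul_apply, smul_eq_mul, ← hcancel]
    ring
  let y : (mulOp μ m).domain := ⟨x, mem_mulOp_domain_of_ae hmul⟩
  have hy : mulOp μ m y = w + k • x := mulOp_eq_of_ae hmul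
  exact ⟨y, by rw [hy, add_sub_cancel_right]⟩

/-- The unitary map that diagonalizes the infinitesimal shift: multiplication by `e^{-ct}` followed
by the Fourier transform. -/
def diagonalization (c : ℝ) : Hc c ≃ₗᵢ[ℂ] Lp ℂ 2 (volume : Measure ℝ) :=
  (LinearIsometryEquiv.ofSurjective (weightIsometry c) (surjective_weightIsometry c)).trans
    (Lp.fourierTransformₗᵢ ℝ ℂ)

/-- The line `Re s = c` parametrized by frequency; diagonalization turns the infinitesimal shift
into multiplication by this function. -/
def symbol (c ξ : ℝ) : ℂ := c + 2 * Real.pi * I * ξ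

theorem continuous_symbol (c : ℝ) : Continuous (symbol c) := by
  unfold symbol
  fun_prop

theorem symbol_sub (c ξ : ℝ) : symbol c ξ - (c + 1) = 2 * Real.pi * I * ξ - 1 := by
  rw [symbol, add_sub_add_left_eq_sub]

theorem memLp_inv_symbol_sub (c : ℝ) :
    MemLp (fun ξ => (symbol c ξ - (c + 1))⁻¹) ∞ (volume : Measure ℝ) := by
  simp only [symbol_sub]
  have hcont : Continuous fun ξ : ℝ => (2 * Real.pi * I * ξ - 1)⁻¹ :=
    (by fun_prop : Continuous fun ξ : ℝ => 2 * Real.pi * I * ξ - 1).inv₀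
      two_pi_I_mul_sub_one_ne_zero
  refine memLp_top_of_bound hcont.aestronglyMeasurable 1 (Eventually.of_forall fun ξ => ?_)
  rw [norm_inv]
  exact inv_le_one_of_one_le₀ (one_le_norm_two_pi_I_mul_sub_one ξ)

variable {c : ℝ}

theorem exists_isAC_weightIsometry {f h : Hc c}
    (hfh : diagonalization c h =ᵐ[volume] fun ξ => symbol c ξ * diagonalization c f ξ) :
    ∃ g : ℝ → ℂ, IsAC g ∧ weightIsometry c f =ᵐ[volume] g ∧
      weightIsometry c (h - (c : ℂ) • f) =ᵐ[volume] deriv g := by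
  refine exists_isAC_of_fourier ?_
  change diagonalization c (h - (c : ℂ) • f) =ᵐ[volume]
    fun ξ => 2 * Real.pi * I * ξ * diagonalization c f ξ
  rw [map_sub, map_smul]
  filter_upwards [Lp.coeFn_sub (diagonalization c h) ((c : ℂ) • diagonalization c f),
    Lp.coeFn_smul (c : ℂ) (diagonalization c f), hfh] with ξ hsub hsmul hξ
  rw [hsub, Pi.sub_apply, hsmul, hξ, Pi.smul_apply, smul_eq_mul, ← sub_mul, symbol,
    add_sub_cancel_left]

theorem mem_infinitesimalShift_graph_of_symbol {f h : Hc c}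
    (hfh : diagonalization c h =ᵐ[volume] fun ξ => symbol c ξ * diagonalization c f ξ) :
    (f, h) ∈ (infinitesimalShift c).graph := by
  obtain ⟨g, hg, hf, hderiv⟩ := exists_isAC_weightIsometry hfh
  have hrep : f =ᵐ[volume] fun t : ℝ => exp (c * t) * g t := by
    filter_upwards [hf, coeFn_weightIsometry c f] with t ht hiso
    rw [← ht, hiso, exp_mul_exp_neg_mul_cancel]
  refine (mem_infinitesimalShift_graph c f h).2 ⟨fun t => exp (c * t) * g t,
    (isAC_exp_mul c).mul hg, (weight_ac_volume c).ae_le hrep, (weight_ac_volume c).ae_le ?_⟩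
  filter_upwards [hrep, hderiv, coeFn_weightIsometry c (h - (c : ℂ) • f),
    (volume_ac_weight c).ae_le (Lp.coeFn_sub h ((c : ℂ) • f)),
    (volume_ac_weight c).ae_le (Lp.coeFn_smul (c : ℂ) f),
    hg.ae_differentiableAt] with t ht hdt hiso hsub hsmul hdiff
  have hprod : deriv (fun t : ℝ => exp (c * t) * g t) t =
      exp (c * t) * c * g t + exp (c * t) * deriv g t :=
    ((hasDerivAt_exp_mul_ofReal c t).mul hdiff.hasDerivAt).deriv
  rw [hprod, ← hdt, hiso, exp_mul_exp_neg_mul_cancel, hsub, Pi.sub_apply, hsmul, Pi.smul_apply, ht,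
    smul_eq_mul]
  ring

theorem eq_zero_of_memLp_mul_exp {C : ℂ} (h : MemLp (fun t : ℝ => C * exp t) 2 volume) : C = 0 := by
  have hconst : MemLp (fun _ : ℝ => C) 2 (volume.restrict (Ici 0)) := by
    refine (h.restrict (Ici 0)).of_le aestronglyMeasurable_const ?_
    filter_upwards [ae_restrict_mem measurableSet_Ici] with t ht
    rw [norm_mul, norm_exp, ofReal_re]
    exact le_mul_of_one_le_right (norm_nonneg _) (Real.one_le_exp ht)
  simpa [memLp_const_iff] using hconst

theorem eq_zero_of_mem_infinitesimalShift_graph {f : Hc c}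
    (hf : (f, ((c : ℂ) + 1) • f) ∈ (infinitesimalShift c).graph) : f = 0 := by
  obtain ⟨g, hg, hfg, hderiv⟩ := (mem_infinitesimalShift_graph c _ _).1 hf
  have hode : ∀ᵐ t : ℝ, deriv g t = ((c : ℂ) + 1) * g t := by
    filter_upwards [(volume_ac_weight c).ae_le hfg, (volume_ac_weight c).ae_le hderiv,
      (volume_ac_weight c).ae_le (Lp.coeFn_smul ((c : ℂ) + 1) f)] with t ht hdt hsmul
    rw [← hdt, hsmul, Pi.smul_apply, ht, smul_eq_mul]
  obtain ⟨C, hC⟩ := hg.eq_mul_exp_of_deriv hode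
  have hmem : MemLp (fun t : ℝ => C * exp t) 2 volume := by
    convert (memLp_weight_iff c g).2 ((memLp_congr_ae hfg).1 (Lp.memLp f)) using 2 with t
    rw [hC, mul_left_comm, ← exp_add]
    ring_nf
  rw [Lp.eq_zero_iff_ae_eq_zero]
  filter_upwards [hfg] with t ht
  rw [ht, hC, eq_zero_of_memLp_mul_exp hmem, zero_mul, Pi.zero_apply]

variable (c)

theorem unitaryConj_mulOp_symbol_le :
    unitaryConj (diagonalization c) (mulOp volume (symbol c)) ≤ infinitesimalShift c := by
  refine LinearPMap.le_of_le_graph ?_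
  rintro ⟨f, h⟩ hfh
  obtain ⟨x, rfl, rfl⟩ := (LinearPMap.mem_graph_iff _).1 hfh
  refine mem_infinitesimalShift_graph_of_symbol ?_
  rw [map_unitaryConj_apply]
  exact coeFn_mulOp _

theorem exists_unitaryConj_mulOp_symbol_sub_smul_eq (w : Hc c) :
    ∃ x : (unitaryConj (diagonalization c) (mulOp volume (symbol c))).domain,
      unitaryConj (diagonalization c) (mulOp volume (symbol c)) x -
        ((c : ℂ) + 1) • (x : Hc c) = w := by
  have hne : ∀ᵐ ξ : ℝ, symbol c ξ ≠ c + 1 := Eventually.of_forall fun ξ => by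
    rw [← sub_ne_zero, symbol_sub]
    exact two_pi_I_mul_sub_one_ne_zero ξ
  obtain ⟨y, hy⟩ := exists_mulOp_sub_smul_eq hne (memLp_inv_symbol_sub c) (diagonalization c w)
  obtain ⟨x, hx⟩ := (diagonalization c).surjective (y : Lp ℂ 2 (volume : Measure ℝ))
  have hmem : x ∈ (unitaryConj (diagonalization c) (mulOp volume (symbol c))).domain := by
    rw [mem_unitaryConj_domain, hx]
    exact y.2
  refine ⟨⟨x, hmem⟩, (diagonalization c).injective ?_⟩
  have hxy : (⟨diagonalization c x, hmem⟩ : (mulOp volume (symbol c)).domain) = y :=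
    Subtype.ext hx
  rw [map_sub, map_smul, map_unitaryConj_apply, hxy, hx, hy]

theorem infinitesimalShift_eq_unitaryConj :
    infinitesimalShift c = unitaryConj (diagonalization c) (mulOp volume (symbol c)) := by
  refine (linearPMap_eq_of_le_of_surjective_of_injective (unitaryConj_mulOp_symbol_le c) (c + 1)
    (exists_unitaryConj_mulOp_symbol_sub_smul_eq c) fun x hx => ?_).symm
  exact eq_zero_of_mem_infinitesimalShift_graph (hx ▸ (infinitesimalShift c).mem_graph x)

theorem isFunctionOf_infinitesimalShift {φ : ℂ → ℂ} (hφ : Measurable φ) :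
    IsFunctionOf (infinitesimalShift c) φ
      (unitaryConj (diagonalization c) (mulOp volume (φ ∘ symbol c))) := by
  rw [infinitesimalShift_eq_unitaryConj]
  exact (isFunctionOf_mulOp (continuous_symbol c).measurable hφ).unitaryConj

end Shift

section Zeta

theorem continuousOn_riemannZeta : ContinuousOn riemannZeta {1}ᶜ := fun _ hs =>
  (differentiableAt_riemannZeta hs).continuousAt.continuousWithinAt

theorem measurable_riemannZeta : Measurable riemannZeta :=
  measurable_of_continuousOn_compl_singleton 1 continuousOn_riemannZeta

theorem spectralOperator_eq_unitaryConj (c : ℝ) :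
    spectralOperator c =
      unitaryConj (diagonalization c) (mulOp volume (riemannZeta ∘ symbol c)) :=
  (isFunctionOf_infinitesimalShift c measurable_riemannZeta).functionalCalculus_eq
    measurable_riemannZeta

theorem isInvertible_spectralOperator_iff_exists_ae_le_norm (c : ℝ) :
    IsInvertible (spectralOperator c) ↔
      ∃ ε : ℝ, 0 < ε ∧ ∀ᵐ ξ : ℝ, ε ≤ ‖riemannZeta (symbol c ξ)‖ := by
  rw [spectralOperator_eq_unitaryConj, isInvertible_unitaryConj_iff]
  exact isInvertible_mulOp_iff (measurable_riemannZeta.comp (continuous_symbol c).measurable)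

theorem symbol_mem_verticalLine {c ξ : ℝ} (hξ : ξ ≠ 0) : symbol c ξ ∈ verticalLine c := by
  refine ⟨by simp [symbol], fun h => hξ ?_⟩
  simpa [symbol, Real.pi_ne_zero] using congrArg im h

theorem exists_symbol_eq {c : ℝ} {s : ℂ} (hs : s.re = c) : ∃ ξ, symbol c ξ = s := by
  have hπ : (Real.pi : ℂ) ≠ 0 := ofReal_ne_zero.2 Real.pi_ne_zero
  have him : 2 * Real.pi * I * ((s.im / (2 * Real.pi) : ℝ) : ℂ) = s.im * I := by
    push_cast
    field_simp
  exact ⟨s.im / (2 * Real.pi), by rw [symbol, him, ← hs, re_add_im]⟩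

theorem zero_notMem_closure_image_iff_exists_le_norm {Y : Type*} {φ : Y → ℂ} {s : Set Y} :
    (0 : ℂ) ∉ closure (φ '' s) ↔ ∃ ε : ℝ, 0 < ε ∧ ∀ y ∈ s, ε ≤ ‖φ y‖ := by
  simp [Metric.mem_closure_iff]

theorem exists_ae_le_norm_iff {φ : ℂ → ℂ} (hφ : ContinuousOn φ {1}ᶜ) (c : ℝ) :
    (∃ ε : ℝ, 0 < ε ∧ ∀ᵐ ξ : ℝ, ε ≤ ‖φ (symbol c ξ)‖) ↔
      (0 : ℂ) ∉ closure (φ '' verticalLine c) := by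
  rw [zero_notMem_closure_image_iff_exists_le_norm]
  refine exists_congr fun ε => and_congr_right fun _ => ⟨fun h s hs => ?_, fun h => ?_⟩
  · obtain ⟨ξ, rfl⟩ := exists_symbol_eq hs.1
    have hcont : ContinuousAt (fun ξ => ‖φ (symbol c ξ)‖) ξ :=
      ((hφ.continuousAt (isOpen_compl_singleton.mem_nhds hs.2)).comp
        (continuous_symbol c).continuousAt).norm
    by_contra! hlt
    have hfreq : ∃ᶠ η in 𝓝 ξ, ε ≤ ‖φ (symbol c η)‖ :=
      mem_closure_iff_frequently.1 (Measure.dense_of_ae h ξ)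
    exact hfreq ((hcont.eventually_lt continuousAt_const hlt).mono fun η hη => hη.not_ge)
  · filter_upwards [compl_mem_ae_iff.2 (measure_singleton (0 : ℝ))] with ξ hξ
    exact h _ (symbol_mem_verticalLine hξ)

theorem zero_notMem_closure_image_iff {Y : Type*} {φ : Y → ℂ} {s : Set Y} :
    (0 : ℂ) ∉ closure (φ '' s) ↔ (∀ y ∈ s, φ y ≠ 0) ∧
      ¬ ∃ u : ℕ → Y, Function.Injective u ∧ (∀ n, u n ∈ s) ∧
        Tendsto (fun n => φ (u n)) atTop (𝓝 0) := by
  constructor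
  · refine fun h => ⟨fun y hy h0 => h (subset_closure ⟨y, hy, h0⟩), ?_⟩
    rintro ⟨u, -, hus, hu⟩
    exact h (mem_closure_of_tendsto hu (Eventually.of_forall fun n => ⟨u n, hus n, rfl⟩))
  · rintro ⟨hne, hseq⟩ h0
    obtain ⟨v, hv, hlim⟩ := mem_closure_iff_seq_limit.1 h0
    choose u hus huv using hv
    have hinv : Tendsto (fun n => ‖φ (u n)‖⁻¹) atTop atTop := by
      simp only [huv]
      refine Tendsto.inv_tendsto_nhdsGT_zero (tendsto_nhdsWithin_iff.2
        ⟨by simpa using hlim.norm, Eventually.of_forall fun n => norm_pos_iff.2 ?_⟩)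
      exact huv n ▸ hne _ (hus n)
    obtain ⟨k, hk, hmono⟩ := strictMono_subseq_of_tendsto_atTop hinv
    refine hseq ⟨u ∘ k, Function.Injective.of_comp (f := fun y => ‖φ y‖⁻¹) hmono.injective,
      fun n => hus _, ?_⟩
    simpa only [Function.comp_def, huv] using hlim.comp hk.tendsto_atTop

end Zeta

end SpectralOp

end

theorem theorem6p4_general (c : ℝ) :
    SpectralOp.IsFunctionOf (SpectralOp.infinitesimalShift c) riemannZeta
      (SpectralOp.spectralOperator c) ∧
    (SpectralOp.IsInvertible (SpectralOp.spectralOperator c) ↔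
      (0 : ℂ) ∉ closure (riemannZeta '' SpectralOp.verticalLine c)) ∧
    ((0 : ℂ) ∉ closure (riemannZeta '' SpectralOp.verticalLine c) ↔
      (∀ s ∈ SpectralOp.verticalLine c, riemannZeta s ≠ 0) ∧
      ¬ ∃ s : ℕ → ℂ, Function.Injective s ∧ (∀ n, s n ∈ SpectralOp.verticalLine c) ∧
        Filter.Tendsto (fun n => riemannZeta (s n)) Filter.atTop (nhds 0)) := by
  refine ⟨?_, ?_, SpectralOp.zero_notMem_closure_image_iff⟩
  · rw [SpectralOp.spectralOperator_eq_unitaryConj]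
    exact SpectralOp.isFunctionOf_infinitesimalShift c SpectralOp.measurable_riemannZeta
  · rw [SpectralOp.isInvertible_spectralOperator_iff_exists_ae_le_norm]
    exact SpectralOp.exists_ae_le_norm_iff SpectralOp.continuousOn_riemannZeta c

theorem theorem6p4 (c : ℝ) (hc : 0 ≤ c) :
    SpectralOp.IsFunctionOf (SpectralOp.infinitesimalShift c) riemannZeta
      (SpectralOp.spectralOperator c) ∧
    (SpectralOp.IsInvertible (SpectralOp.spectralOperator c) ↔
      (0 : ℂ) ∉ closure (riemannZeta '' SpectralOp.verticalLine c)) ∧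
    ((0 : ℂ) ∉ closure (riemannZeta '' SpectralOp.verticalLine c) ↔
      (∀ s ∈ SpectralOp.verticalLine c, riemannZeta s ≠ 0) ∧
      ¬ ∃ s : ℕ → ℂ, Function.Injective s ∧ (∀ n, s n ∈ SpectralOp.verticalLine c) ∧
        Filter.Tendsto (fun n => riemannZeta (s n)) Filter.atTop (nhds 0)) :=
  theorem6p4_general c
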